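/- Let $n,k$ be integers with $0<k\le n-1$. The bandwidth of a matrix $A=(a_{ij})\in\mathbb{C}^{n\times n}$ is $\max\{|j-i| : a_{ij}\neq 0\}$ (and $0$ for $A=0$). Let $\mathcal{N}$ be the real vector space of Hermitian $n\times n$ matrices of bandwidth at most $k$, and let $\mathcal{D}\subset\mathcal{N}$ be the set of derogatory matrices in $\mathcal{N}$, i.e. those having an eigenvalue of geometric multiplicity greater than $1$. Then $\dim_{\mathbb{R}}\mathcal{N}=n(2k+1)-k(k+1)$, and $\mathcal{D}$ has real codimension $3$ in $\mathcal{N}$, in the following sense: there is a nonempty, relatively open subset $\mathcal{R}\subseteq\mathcal{D}$ that is an embedded smooth submanifold of $\mathcal{N}$ of codimension $3$, and the remaining degenerate part $\mathcal{D}\setminus\mathcal{R}$ has Hausdorff dimension strictly less than $\dim_{\mathbb{R}}\mathcal{N}-3$. In particular, the Hausdorff dimension of $\mathcal{D}$ is exactly $\dim_{\mathbb{R}}\mathcal{N}-3$. -/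

import Mathlib

open scoped ContDiff

/- The real vector space of complex matrices carries the norm given by the largest modulus of an
entry. All norms on it are equivalent, so smoothness and Hausdorff dimension do not depend on
this choice. -/
attribute [local instance] Matrix.normedAddCommGroup Matrix.normedSpace

namespace BandedHermitian

/-- The bandwidth of a square matrix: the maximum of `|j - i|` over all `(i, j)` with
`A i j ≠ 0` (and `0` for the zero matrix). -/
noncomputable def bandwidth {n : ℕ} (A : Matrix (Fin n) (Fin n) ℂ) : ℕ := by
  classical
  exact (Finset.univ.filter fun p : Fin n × Fin n => A p.1 p.2 ≠ 0).sup
    fun p => ((p.2 : ℤ) - (p.1 : ℤ)).natAbs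

theorem bandwidth_le_iff {n : ℕ} (A : Matrix (Fin n) (Fin n) ℂ) (k : ℕ) :
    bandwidth A ≤ k ↔ ∀ i j : Fin n, A i j ≠ 0 → ((j : ℤ) - (i : ℤ)).natAbs ≤ k := by
  classical
  simp only [bandwidth, Finset.sup_le_iff, Finset.mem_filter, Finset.mem_univ, true_and,
    Prod.forall]

/-- The real vector space of Hermitian `n × n` matrices of bandwidth (at most) `k`. -/
noncomputable def bandHerm (n k : ℕ) : Submodule ℝ (Matrix (Fin n) (Fin n) ℂ) where
  carrier := {A | A.IsHermitian ∧ bandwidth A ≤ k}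
  zero_mem' := by
    refine ⟨Matrix.isHermitian_zero, (bandwidth_le_iff _ _).2 fun i j h => ?_⟩
    exact absurd rfl h
  add_mem' := by
    rintro A B ⟨hA, hA'⟩ ⟨hB, hB'⟩
    rw [bandwidth_le_iff] at hA' hB'
    refine ⟨hA.add hB, (bandwidth_le_iff _ _).2 fun i j h => ?_⟩
    by_cases hAij : A i j = 0
    · by_cases hBij : B i j = 0
      · exact absurd (by simp [hAij, hBij]) h
      · exact hB' i j hBij
    · exact hA' i j hAij
  smul_mem' := by
    rintro c A ⟨hA, hA'⟩
    rw [bandwidth_le_iff] at hA'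
    refine ⟨?_, (bandwidth_le_iff _ _).2 fun i j h => hA' i j fun h0 => h (by simp [h0])⟩
    change (c • A).conjTranspose = c • A
    rw [Matrix.conjTranspose_smul, hA.eq, star_trivial]

/-- A square matrix is derogatory if it has an eigenvalue of geometric multiplicity
greater than `1`. -/
def IsDerogatory {n : ℕ} (A : Matrix (Fin n) (Fin n) ℂ) : Prop :=
  ∃ μ : ℂ, 1 < Module.finrank ℂ (Module.End.eigenspace (Matrix.toLin' A) μ)

/-- The derogatory matrices, as a subset of the space of Hermitian matrices of bandwidth `k`. -/
def derogatorySet (n k : ℕ) : Set (bandHerm n k) :=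
  {A | IsDerogatory (A : Matrix (Fin n) (Fin n) ℂ)}

/-- `M` is an embedded smooth submanifold of codimension `c` of the normed space `E`: around each
of its points it is the zero set of a smooth submersion to `ℝᶜ`. -/
def IsSmoothSubmanifold {E : Type*} [NormedAddCommGroup E] [NormedSpace ℝ E]
    (c : ℕ) (M : Set E) : Prop :=
  ∀ x ∈ M, ∃ U : Set E, IsOpen U ∧ x ∈ U ∧ ∃ f : E → EuclideanSpace ℝ (Fin c),
    ContDiffOn ℝ ∞ f U ∧ (∀ y ∈ U, Function.Surjective (fderiv ℝ f y)) ∧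
      M ∩ U = {y ∈ U | f y = 0}

/-- The possibly singular subset `M` of the finite-dimensional space `E` has codimension `c`:
a nonempty, relatively open part `R` of `M` is an embedded smooth submanifold of codimension `c`,
and what remains of `M` has dimension strictly less than `dim E - c`, the dimension of `R`. -/
def HasCodimension {E : Type*} [NormedAddCommGroup E] [NormedSpace ℝ E]
    (M : Set E) (c : ℕ) : Prop :=
  ∃ R : Set E, R ⊆ M ∧ R.Nonempty ∧ (∃ V : Set E, IsOpen V ∧ R = M ∩ V) ∧
    IsSmoothSubmanifold c R ∧ dimH (M \ R) + c < Module.finrank ℝ E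

end BandedHermitian

/-! Let `v`, `w` be orthonormal eigenvectors of `A` for a double eigenvalue `s`. A nearby matrix
keeps a double eigenvalue when a 2×2 Hermitian matrix attached to `span {v, w}` is scalar, which
gives three real equations once the eigenvalue is eliminated. If the eigenspace is exactly
two-dimensional, there is no other multiple eigenvalue, and the compression `X ↦ (v*Xv, w*Xw, v*Xw)`
maps the band matrices onto `ℝ × ℝ × ℂ`, these equations form a submersion (`exists_submersion`).
Inside a band the compression need not be onto, and the main work is to show that the exceptional
matrices have codimension at least 4.

Exceptional sets are measured by ranks. Endomorphisms near `M₀` of the same rank lie in the zero set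
of a smooth map whose derivative kills only `X` with `ψ (X v) = 0` whenever `v` is in the kernel of
`M₀` and `ψ` annihilates its range. Stratifying by the ranks of all submatrices, not only of `A -
s`, bounds the Hausdorff dimension by the dimension of the space of `X` meeting all these conditions
(`dimH_le_of_finrank_stratumTangent`). Five independent real conditions on `A - s` suffice, since
letting `s` vary gives back only one dimension.

The conditions come from the band structure. If the compression is not onto, a nonzero traceless,
hence invertible, Hermitian 2×2 matrix is orthogonal to its image. This forces `v i * w j = v j * w
i` within the band, so the kernel vectors have a gap of at least `k` indices (`exists_gap`). A band
matrix decouples across such a gap, and induction on the length of an index interval yields the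
fifth condition (`finrank_bandTangent_of_isOrthonormalPair`). Corank at least three either gives
five conditions directly or reduces to this case.

The remaining exception is a pair of distinct multiple eigenvalues. With both eigenvalues as extra
variables there are at least six independent conditions, so the codimension is again at least 4
(`dimH_two_double_eigenvalues_le`). -/

namespace BandedHermitian

open Filter Topology Module

/-! ### Hausdorff dimension of level sets, stratified sets and submanifolds. -/

section Dimension

variable {E F : Type*} [NormedAddCommGroup E] [NormedSpace ℝ E] [FiniteDimensional ℝ E]
  [NormedAddCommGroup F] [NormedSpace ℝ F]

/-- A subset of a level set of a map with strict derivative `f'` at `x` has, near `x`, Hausdorff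
dimension at most the dimension of the kernel of `f'`. -/
theorem exists_nhds_dimH_inter_le {f : E → F} {f' : E →L[ℝ] F} {x : E}
    (hf : HasStrictFDerivAt f f' x) {T : Set E} (hT : ∀ y ∈ T, f y = f x) :
    ∃ U ∈ 𝓝 x, dimH (T ∩ U) ≤ finrank ℝ (LinearMap.ker f'.toLinearMap) := by
  set K := LinearMap.ker f'.toLinearMap with hK
  obtain ⟨p, hp⟩ := K.subtype.exists_leftInverse_of_injective (by simp)
  set π : E →L[ℝ] K := LinearMap.toContinuousLinearMap p with hπ
  have hker : LinearMap.ker (f'.prod π).toLinearMap = ⊥ := by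
    rw [LinearMap.ker_eq_bot']
    intro m hm
    have h1 : f' m = 0 := congrArg Prod.fst hm
    have h2 : p m = 0 := congrArg Prod.snd hm
    have h3 := LinearMap.congr_fun hp ⟨m, h1⟩
    simp only [LinearMap.comp_apply, Submodule.subtype_apply, LinearMap.id_apply, h2] at h3
    exact (congrArg Subtype.val h3).symm
  obtain ⟨C, hC, hanti⟩ := (f'.prod π).toLinearMap.exists_antilipschitzWith hker
  -- On a level set `f' (y - z)` has norm at most `‖y - z‖ / (2C)`, half of what the antilipschitz
  -- bound for `(f', π)` asks for. So `π` alone must be antilipschitz there.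
  obtain ⟨s, hs, happ⟩ := hf.approximates_deriv_on_nhds (c := (2 * C)⁻¹)
    (Or.inr (by positivity))
  refine ⟨s, hs, ?_⟩
  have key : ∀ y ∈ T ∩ s, ∀ z ∈ T ∩ s, ‖y - z‖ ≤ C * ‖π (y - z)‖ := by
    intro y hy z hz
    have h1 := happ y hy.2 z hz.2
    rw [hT y hy.1, hT z hz.1, sub_self, zero_sub, norm_neg] at h1
    have h2 := hanti.le_mul_dist y z
    rw [dist_eq_norm, dist_eq_norm, ← map_sub] at h2
    have h3 : ‖(f'.prod π) (y - z)‖ = max ‖f' (y - z)‖ ‖π (y - z)‖ := rfl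
    have hC' : (0 : ℝ) < C := hC
    change ‖y - z‖ ≤ C * ‖(f'.prod π) (y - z)‖ at h2
    rw [h3] at h2
    rcases le_total ‖f' (y - z)‖ ‖π (y - z)‖ with h | h
    · rwa [max_eq_right h] at h2
    · rw [max_eq_left h] at h2
      have h4 : (C : ℝ) * ‖f' (y - z)‖ ≤ C * (((2 * C)⁻¹ : NNReal) * ‖y - z‖) := by gcongr
      have h5 : (C : ℝ) * (((2 * C)⁻¹ : NNReal) * ‖y - z‖) = ‖y - z‖ / 2 := by
        push_cast; field_simp
      have h6 : ‖y - z‖ ≤ 0 := by linarith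
      exact h6.trans (by positivity)
  have hA : AntilipschitzWith C (fun y : (T ∩ s : Set E) => π y) := by
    refine AntilipschitzWith.of_le_mul_dist fun y z => ?_
    rw [Subtype.dist_eq, dist_eq_norm, dist_eq_norm, ← map_sub]
    exact key y y.2 z z.2
  calc dimH (T ∩ s) = dimH (Subtype.val '' (Set.univ : Set (T ∩ s : Set E))) := by simp
    _ = dimH (Set.univ : Set (T ∩ s : Set E)) := isometry_subtype_coe.dimH_image _
    _ ≤ dimH ((fun y : (T ∩ s : Set E) => π y) '' Set.univ) := hA.le_dimH_image _
    _ ≤ dimH (Set.univ : Set K) := dimH_mono (Set.subset_univ _)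
    _ = finrank ℝ K := Real.dimH_univ_eq_finrank K

/-- A dimension bound for a set that is stratified by a countably valued function, when at each
point its stratum is contained in a level set of a map with small kernel of the derivative. -/
theorem dimH_le_of_stratification {E F ι : Type*} [NormedAddCommGroup E] [NormedSpace ℝ E]
    [FiniteDimensional ℝ E] [NormedAddCommGroup F] [NormedSpace ℝ F] [Countable ι]
    (S : Set E) (σ : E → ι) (d : ℕ)
    (h : ∀ x ∈ S, ∃ (f : E → F) (f' : E →L[ℝ] F), HasStrictFDerivAt f f' x ∧
      finrank ℝ (LinearMap.ker f'.toLinearMap) ≤ d ∧ ∀ᶠ y in 𝓝 x, y ∈ S → σ y = σ x → f y = f x) :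
    dimH S ≤ d := by
  have hS : S = ⋃ i, S ∩ σ ⁻¹' {i} := by ext; simp
  rw [hS, dimH_iUnion]
  refine iSup_le fun i => ?_
  by_contra hlt
  push Not at hlt
  -- A set of dimension above `d` has a point all of whose relative neighbourhoods have dimension
  -- above `d`. The local bound at that point gives the contradiction, so no regularity of the
  -- strata is needed.
  obtain ⟨x, ⟨hxS, hxi⟩, hx⟩ := exists_mem_nhdsWithin_lt_dimH_of_lt_dimH hlt
  obtain ⟨f, f', hf, hd, hev⟩ := h x hxS
  obtain ⟨V, hV, hVf⟩ := hev.exists_mem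
  obtain ⟨U, hU, hUd⟩ := exists_nhds_dimH_inter_le hf (T := (S ∩ σ ⁻¹' {i}) ∩ V)
    (fun y hy => hVf y hy.2 hy.1.1 (hy.1.2.trans hxi.symm))
  have hmem : (S ∩ σ ⁻¹' {i}) ∩ V ∩ U ∈ 𝓝[S ∩ σ ⁻¹' {i}] x := by
    rw [Set.inter_assoc]
    exact inter_mem_nhdsWithin _ (inter_mem hV hU)
  exact absurd (hx _ hmem) (not_lt.2 (hUd.trans (by exact_mod_cast hd)))

theorem dimH_le_of_isSmoothSubmanifold {c : ℕ} {M : Set E} (hM : IsSmoothSubmanifold c M) :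
    dimH M ≤ (finrank ℝ E - c : ℕ) := by
  refine dimH_le_of_stratification (F := EuclideanSpace ℝ (Fin c)) M (fun _ => ()) _ fun x hx => ?_
  obtain ⟨U, hU, hxU, f, hf, hsurj, hMU⟩ := hM x hx
  have hs : HasStrictFDerivAt f (fderiv ℝ f x) x :=
    (hf.contDiffAt (hU.mem_nhds hxU)).hasStrictFDerivAt (by simp)
  refine ⟨f, fderiv ℝ f x, hs, ?_, ?_⟩
  · have h1 := (fderiv ℝ f x).toLinearMap.finrank_range_add_finrank_ker
    rw [LinearMap.range_eq_top.2 (hsurj x hxU), finrank_top, finrank_euclideanSpace_fin] at h1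
    omega
  · have hx0 : x ∈ {y ∈ U | f y = 0} := hMU ▸ ⟨hx, hxU⟩
    filter_upwards [hU.mem_nhds hxU] with y hy hyM _
    have hy0 : y ∈ {y ∈ U | f y = 0} := hMU ▸ ⟨hyM, hy⟩
    rw [hy0.2, hx0.2]

/-- By the implicit function theorem, the Lipschitz map `y ↦ p (y - x)` sends `M` onto a set
containing a neighbourhood of `0` in the kernel of the derivative. -/
theorem le_dimH_of_isSmoothSubmanifold {c : ℕ} {M : Set E} (hM : IsSmoothSubmanifold c M)
    (hne : M.Nonempty) : (finrank ℝ E : ENNReal) ≤ dimH M + c := by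
  obtain ⟨x, hx⟩ := hne
  obtain ⟨U, hU, hxU, f, hf, hsurj, hMU⟩ := hM x hx
  have hs : HasStrictFDerivAt f (fderiv ℝ f x) x :=
    (hf.contDiffAt (hU.mem_nhds hxU)).hasStrictFDerivAt (by simp)
  have hx0 : x ∈ {y ∈ U | f y = 0} := hMU ▸ ⟨hx, hxU⟩
  have hr : (fderiv ℝ f x).range = ⊤ := LinearMap.range_eq_top.2 (hsurj x hxU)
  have hfr := (fderiv ℝ f x).toLinearMap.finrank_range_add_finrank_ker
  rw [LinearMap.range_eq_top.2 (hsurj x hxU), finrank_top, finrank_euclideanSpace_fin] at hfr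
  have hker := (fderiv ℝ f x).ker_closedComplemented_of_finiteDimensional_range
  set e := hs.implicitToOpenPartialHomeomorphOfComplemented f _ hr hker with he
  have hxe : x ∈ e.source := hs.mem_implicitToOpenPartialHomeomorphOfComplemented_source hr hker
  have hex : e x = (0, 0) := by
    rw [← hx0.2]; exact hs.implicitToOpenPartialHomeomorphOfComplemented_self hr hker
  obtain ⟨p, hp⟩ : ∃ p : E →L[ℝ] (fderiv ℝ f x).ker, ∀ y, e y = (f y, p (y - x)) :=
    ⟨_, hs.implicitToOpenPartialHomeomorphOfComplemented_apply hr hker⟩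
  have hxt : ((0 : EuclideanSpace ℝ (Fin c)), (0 : (fderiv ℝ f x).ker)) ∈ e.target := hex ▸ e.map_source hxe
  have htend : Tendsto e.symm (𝓝 (0, 0)) (𝓝 x) := by
    have := e.tendsto_symm hxe
    rwa [hex] at this
  have hpair : Tendsto (fun z : (fderiv ℝ f x).ker => ((0 : EuclideanSpace ℝ (Fin c)), z)) (𝓝 0) (𝓝 (0, 0)) :=
    (Continuous.prodMk_right _).tendsto' _ _ rfl
  have hB : ∀ᶠ z : (fderiv ℝ f x).ker in 𝓝 0, z ∈ (fun y => p (y - x)) '' M := by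
    filter_upwards [hpair (e.open_target.mem_nhds hxt),
      hpair (htend (hU.mem_nhds hxU))] with z hz1 hz2
    have h1 := e.right_inv hz1
    rw [hp] at h1
    have h2 : e.symm (0, z) ∈ M ∩ U := by
      rw [hMU]; exact ⟨hz2, congrArg Prod.fst h1⟩
    exact ⟨e.symm (0, z), h2.1, congrArg Prod.snd h1⟩
  have hlip : LipschitzWith ‖p‖₊ (fun y => p (y - x)) := by
    have := p.lipschitz.comp ((IsometryEquiv.subRight x).isometry.lipschitz)
    rwa [mul_one] at this
  have h1 : (finrank ℝ (fderiv ℝ f x).ker : ENNReal) ≤ dimH M := by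
    rw [← Real.dimH_of_mem_nhds hB]
    exact hlip.dimH_image_le M
  calc (finrank ℝ E : ENNReal) = finrank ℝ (fderiv ℝ f x).ker + c := by rw [← hfr]; push_cast; rw [add_comm]
    _ ≤ dimH M + c := by gcongr

theorem dimH_eq_of_hasCodimension {c : ℕ} {M : Set E} (hM : HasCodimension M c) :
    dimH M + c = finrank ℝ E := by
  obtain ⟨R, hRM, hne, -, hR, hlt⟩ := hM
  have h1 := le_dimH_of_isSmoothSubmanifold hR hne
  have h2 := dimH_le_of_isSmoothSubmanifold hR
  have hc : c ≤ finrank ℝ E := by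
    have : (c : ENNReal) < finrank ℝ E := lt_of_le_of_lt le_add_self hlt
    exact_mod_cast this.le
  have h3 : ((finrank ℝ E - c : ℕ) : ENNReal) + c = finrank ℝ E := by
    exact_mod_cast Nat.sub_add_cancel hc
  refine le_antisymm ?_ (h1.trans (by gcongr))
  have h4 : M = R ∪ M \ R := (Set.union_sdiff_cancel hRM).symm
  rw [h4, dimH_union]
  rcases le_total (dimH R) (dimH (M \ R)) with h | h
  · rw [max_eq_right h]; exact hlt.le
  · rw [max_eq_left h, ← h3]; gcongr

end Dimension

/-! ### Equations for endomorphisms of constant rank. -/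

section ConstantRank

theorem exists_reflexive_generalizedInverse {𝕜 V W : Type*} [Field 𝕜] [AddCommGroup V]
    [Module 𝕜 V] [AddCommGroup W] [Module 𝕜 W] (M : V →ₗ[𝕜] W) :
    ∃ B : W →ₗ[𝕜] V, M ∘ₗ B ∘ₗ M = M ∧ B ∘ₗ M ∘ₗ B = B := by
  obtain ⟨s, hs⟩ := M.rangeRestrict.exists_rightInverse_of_surjective M.range_rangeRestrict
  obtain ⟨p, hp⟩ := M.range.subtype.exists_leftInverse_of_injective (by simp)
  have h1 : ∀ y : M.range, M (s y) = y := fun y => congrArg Subtype.val (LinearMap.congr_fun hs y)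
  have h2 : ∀ y : M.range, p y = y := fun y => LinearMap.congr_fun hp y
  refine ⟨s ∘ₗ p, LinearMap.ext fun x => ?_, LinearMap.ext fun y => ?_⟩
  · have := h2 ⟨M x, LinearMap.mem_range_self M x⟩
    simp only at this
    simp [this, h1]
  · simp [h1, h2]

variable {V : Type*} [NormedAddCommGroup V] [NormedSpace ℂ V] [FiniteDimensional ℂ V]

/-- A function with values in the endomorphisms of `V` that vanishes at the endomorphisms near
`M₀` of the same rank as `M₀`, provided that `B` is a reflexive generalized inverse of `M₀`. -/
noncomputable def rankDefect (M₀ B : V →L[ℂ] V) (M : V →L[ℂ] V) : V →L[ℂ] V :=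
  (1 - M₀ * B) * (M * Ring.inverse (1 + B * (M - M₀))) * (1 - B * M₀)

/-- In the product rule the term that differentiates the inverse carries a left factor `(1 - M₀ * B)
* M₀ = 0`, so only the term linear in the increment survives. -/
theorem hasStrictFDerivAt_rankDefect {M₀ B : V →L[ℂ] V} (h : M₀ * B * M₀ = M₀) :
    HasStrictFDerivAt (rankDefect M₀ B)
      (ContinuousLinearMap.mulLeftRight ℂ (V →L[ℂ] V) (1 - M₀ * B) (1 - B * M₀)) M₀ := by
  have : CompleteSpace V := FiniteDimensional.complete ℂ V
  have hid : HasStrictFDerivAt (fun M : V →L[ℂ] V => M) (ContinuousLinearMap.id ℂ _) M₀ :=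
    hasStrictFDerivAt_id M₀
  have h1 : HasStrictFDerivAt (fun M : V →L[ℂ] V => 1 + B * (M - M₀))
      (ContinuousLinearMap.mul ℂ (V →L[ℂ] V) B) M₀ := by
    exact ((ContinuousLinearMap.mul ℂ (V →L[ℂ] V) B).hasStrictFDerivAt.comp M₀
      (hid.sub_const M₀)).const_add 1
  have h2 : HasStrictFDerivAt (fun M : V →L[ℂ] V => Ring.inverse (1 + B * (M - M₀)))
      ((-ContinuousLinearMap.mulLeftRight ℂ (V →L[ℂ] V) 1 1).comp
        (ContinuousLinearMap.mul ℂ (V →L[ℂ] V) B)) M₀ := by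
    have := hasStrictFDerivAt_ringInverse (𝕜 := ℂ) (1 : (V →L[ℂ] V)ˣ)
    refine HasStrictFDerivAt.comp M₀ (g := Ring.inverse) ?_ h1
    simpa using this
  have h3 := (ContinuousLinearMap.mulLeftRight ℂ (V →L[ℂ] V) (1 - M₀ * B)
    (1 - B * M₀)).hasStrictFDerivAt.comp M₀ (hid.mul' h2)
  convert! h3 using 1
  have h4 : (1 - M₀ * B) * M₀ = 0 := by rw [sub_mul, h, one_mul, sub_self]
  ext1 X
  simp only [ContinuousLinearMap.mulLeftRight_apply, smul_apply,
    add_apply, ContinuousLinearMap.comp_apply, smul_eq_mul,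
    neg_apply, ContinuousLinearMap.mul_apply',
    MulOpposite.smul_eq_mul_unop, MulOpposite.unop_op, sub_self, mul_zero, add_zero,
    Ring.inverse_one, ContinuousLinearMap.id_apply, mul_one, mul_add, ← mul_assoc, h4]
  simp

/-- With `Z` the inverse of `1 + B * (M - M₀)`, reflexivity gives `B * M * Z = B * M₀`, so `M * Z`
has kernel inside that of `M₀`. Equal ranks force equality of the kernels, and `1 - B * M₀` maps
into the kernel of `M₀`. -/
theorem eventually_rankDefect_eq_zero {M₀ B : V →L[ℂ] V} (h : M₀ * B * M₀ = M₀)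
    (h' : B * M₀ * B = B) :
    ∀ᶠ M in 𝓝 M₀, finrank ℂ M.range = finrank ℂ M₀.range → rankDefect M₀ B M = 0 := by
  have : CompleteSpace V := FiniteDimensional.complete ℂ V
  have hc : ContinuousAt (fun M : V →L[ℂ] V => 1 + B * (M - M₀)) M₀ := by fun_prop
  have hu : ∀ᶠ M in 𝓝 M₀, IsUnit (1 + B * (M - M₀)) := by
    refine hc (Units.isOpen.mem_nhds ?_)
    simp
  filter_upwards [hu] with M hM hr
  set Z := Ring.inverse (1 + B * (M - M₀)) with hZ
  have hZ1 : (1 + B * (M - M₀)) * Z = 1 := Ring.mul_inverse_cancel _ hM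
  have hBM : B * (M * Z) = B * M₀ := by
    have : B * M = B * M₀ * (1 + B * (M - M₀)) := by
      have : B * M₀ * (1 + B * (M - M₀)) = B * M₀ + B * M₀ * B * (M - M₀) := by noncomm_ring
      rw [this, h']; noncomm_ring
    rw [← mul_assoc, this, mul_assoc, hZ1, mul_one]
  have hle : (M * Z).ker ≤ M₀.ker := by
    intro x hx
    have hx' : (M * Z) x = 0 := hx
    have h1 : (B * M₀) x = 0 := by rw [← hBM, mul_apply_eq_comp, hx', map_zero]
    change M₀ x = 0
    rw [← h, mul_assoc, mul_apply_eq_comp, h1, map_zero]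
  have hrank : finrank ℂ (M * Z).range ≤ finrank ℂ M₀.range := by
    rw [← hr]
    refine Submodule.finrank_mono ?_
    rintro _ ⟨x, rfl⟩
    exact ⟨Z x, rfl⟩
  have e1 := (M * Z).toLinearMap.finrank_range_add_finrank_ker
  have e2 := M₀.toLinearMap.finrank_range_add_finrank_ker
  have hker : (M * Z).ker = M₀.ker := Submodule.eq_of_le_of_finrank_le hle (by omega)
  have h5 : M * Z * (1 - B * M₀) = 0 := by
    ext1 x
    have hx : (1 - B * M₀) x ∈ M₀.ker := by
      change M₀ ((1 - B * M₀) x) = 0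
      rw [← mul_apply_eq_comp, mul_sub, ← mul_assoc, h]
      simp
    rw [← hker] at hx
    exact hx
  rw [rankDefect, ← hZ, mul_assoc, h5, mul_zero]

theorem exists_rankDefect_inverse (M₀ : V →L[ℂ] V) :
    ∃ B : V →L[ℂ] V, M₀ * B * M₀ = M₀ ∧ B * M₀ * B = B := by
  obtain ⟨B, h1, h2⟩ := exists_reflexive_generalizedInverse M₀.toLinearMap
  refine ⟨LinearMap.toContinuousLinearMap B, ?_, ?_⟩
  · ext1 x; exact LinearMap.congr_fun h1 x
  · ext1 x; exact LinearMap.congr_fun h2 x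

/-- The endomorphisms near `M₀` of the same rank lie in the zero set of a map whose derivative
kills only endomorphisms mapping the kernel of `M₀` to the range of `M₀`. -/
theorem exists_map_vanishing_of_rank_eq (M₀ : V →L[ℂ] V) :
    ∃ (φ : (V →L[ℂ] V) → (V →L[ℂ] V)) (D : (V →L[ℂ] V) →L[ℝ] (V →L[ℂ] V)),
      HasStrictFDerivAt φ D M₀ ∧ φ M₀ = 0 ∧
      (∀ᶠ M in 𝓝 M₀, finrank ℂ M.range = finrank ℂ M₀.range → φ M = 0) ∧
      ∀ X, D X = 0 → ∀ (v : V) (ψ : V →ₗ[ℂ] ℂ), M₀ v = 0 → (∀ y, ψ (M₀ y) = 0) → ψ (X v) = 0 := by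
  obtain ⟨B, h1, h2⟩ := exists_rankDefect_inverse M₀
  refine ⟨rankDefect M₀ B, _, (hasStrictFDerivAt_rankDefect h1).restrictScalars ℝ, ?_,
    eventually_rankDefect_eq_zero h1 h2, ?_⟩
  · have h4 : (1 - M₀ * B) * M₀ = 0 := by rw [sub_mul, h1, one_mul, sub_self]
    simp [rankDefect, h4]
  · intro X hX v ψ hv hψ
    have hX' : (1 - M₀ * B) * X * (1 - B * M₀) = 0 := hX
    have h5 := congrArg (fun T : V →L[ℂ] V => ψ (T v)) hX'
    simpa [hv, hψ] using h5

end ConstantRank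

/-! ### Stratification of matrices by the ranks of all submatrices. -/

section Strata

open Matrix

variable {n : ℕ}

/-- `v` is in the kernel of the rows of `A` indexed by the support of `w`, and vice versa. -/
def IsKernelPair (A : Matrix (Fin n) (Fin n) ℂ) (v w : Fin n → ℂ) : Prop :=
  (∀ i, w i ≠ 0 → (A *ᵥ v) i = 0) ∧ ∀ j, v j ≠ 0 → (A *ᵥ w) j = 0

/-- The directions along which, to first order, the ranks of the submatrices of `A` with rows and
columns in `S` are constant. -/
def stratumTangent (A : Matrix (Fin n) (Fin n) ℂ) (S : Set (Fin n)) :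
    Submodule ℝ (Matrix (Fin n) (Fin n) ℂ) where
  carrier := {X | ∀ v w, (∀ i, v i ≠ 0 → i ∈ S) → (∀ i, w i ≠ 0 → i ∈ S) → IsKernelPair A v w →
    star w ⬝ᵥ X *ᵥ v = 0}
  zero_mem' := by simp
  add_mem' := by
    intro X Y hX hY v w hv hw h
    rw [add_mulVec, dotProduct_add, hX v w hv hw h, hY v w hv hw h, add_zero]
  smul_mem' := by
    intro c X hX v w hv hw h
    rw [smul_mulVec, dotProduct_smul, hX v w hv hw h, smul_zero]

theorem mem_stratumTangent {A X : Matrix (Fin n) (Fin n) ℂ} {S : Set (Fin n)} :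
    X ∈ stratumTangent A S ↔ ∀ v w, (∀ i, v i ≠ 0 → i ∈ S) → (∀ i, w i ≠ 0 → i ∈ S) →
      IsKernelPair A v w → star w ⬝ᵥ X *ᵥ v = 0 := Iff.rfl

/-- The matrix `A` with the rows outside `P` and the columns outside `Q` replaced by zero,
as an endomorphism. -/
noncomputable def blockMap (P Q : Finset (Fin n)) :
    Matrix (Fin n) (Fin n) ℂ →ₗ[ℂ] ((Fin n → ℂ) →L[ℂ] (Fin n → ℂ)) :=
  LinearMap.toContinuousLinearMap.toLinearMap ∘ₗ (Matrix.toLin').toLinearMap ∘ₗ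
    { toFun := fun A => Matrix.of fun i j => if i ∈ P ∧ j ∈ Q then A i j else 0
      map_add' := by
        intro A B; ext i j; by_cases h : i ∈ P ∧ j ∈ Q <;> simp [h]
      map_smul' := by
        intro c A; ext i j; by_cases h : i ∈ P ∧ j ∈ Q <;> simp [h] }

theorem blockMap_apply (P Q : Finset (Fin n)) (A : Matrix (Fin n) (Fin n) ℂ) (v : Fin n → ℂ)
    (i : Fin n) :
    blockMap P Q A v i = ∑ j, (if i ∈ P ∧ j ∈ Q then A i j else 0) * v j := rfl

theorem blockMap_apply_of_support {P Q : Finset (Fin n)} (A : Matrix (Fin n) (Fin n) ℂ)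
    {v : Fin n → ℂ} (hv : ∀ j, v j ≠ 0 → j ∈ Q) (i : Fin n) :
    blockMap P Q A v i = if i ∈ P then (A *ᵥ v) i else 0 := by
  rw [blockMap_apply]
  split_ifs with h
  · rw [mulVec, dotProduct]
    refine Finset.sum_congr rfl fun j _ => ?_
    by_cases hj : v j = 0
    · simp [hj]
    · simp [h, hv j hj]
  · simp [h]

theorem star_dotProduct_blockMap {P Q : Finset (Fin n)} {A : Matrix (Fin n) (Fin n) ℂ}
    (hA : A.IsHermitian) {w : Fin n → ℂ} (hw : ∀ j, w j ≠ 0 → j ∈ P)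
    (hAw : ∀ j ∈ Q, (A *ᵥ w) j = 0) (x : Fin n → ℂ) :
    star w ⬝ᵥ blockMap P Q A x = 0 := by
  simp only [dotProduct, blockMap_apply, Finset.mul_sum]
  rw [Finset.sum_comm]
  refine Finset.sum_eq_zero fun j _ => ?_
  by_cases hj : j ∈ Q
  · have h1 := congrArg star (hAw j hj)
    rw [mulVec, dotProduct, star_sum, star_zero] at h1
    have h2 : ∀ i, star w i * ((if i ∈ P ∧ j ∈ Q then A i j else 0) * x j)
        = star (A j i * w i) * x j := by
      intro i
      by_cases hi : w i = 0
      · simp [hi]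
      · simp only [hw i hi, hj, and_self, if_true, star_mul', hA.apply i j, Pi.star_apply]
        ring
    simp only [h2]
    rw [← Finset.sum_mul, h1, zero_mul]
  · simp [hj]

variable {E : Type*} [NormedAddCommGroup E] [NormedSpace ℝ E] [FiniteDimensional ℝ E]

/-- The ranks of all submatrices. -/
noncomputable def rankTable (A : Matrix (Fin n) (Fin n) ℂ) :
    Finset (Fin n) × Finset (Fin n) → ℕ :=
  fun p => finrank ℂ (blockMap p.1 p.2 A).range

/-- For a kernel pair `(v, w)` of a Hermitian matrix, consider the submatrix with rows in the
support of `w` and columns in the support of `v`. Then `v` is in its kernel and `w*` annihilates its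
range, so constancy of its rank forces `w*Xv = 0` to first order. The table of all these ranks takes
countably many values and serves as the stratifying function. -/
theorem dimH_le_of_finrank_stratumTangent {κ : Type} [Fintype κ] (S : Set E)
    (Λ : κ → E →ₗ[ℝ] Matrix (Fin n) (Fin n) ℂ) (d : ℕ)
    (hherm : ∀ a, ∀ x ∈ S, (Λ a x).IsHermitian)
    (h : ∀ x ∈ S, finrank ℝ (⨅ a, (stratumTangent (Λ a x) Set.univ).comap (Λ a) :
      Submodule ℝ E) ≤ d) :
    dimH S ≤ d := by
  classical
  let Λ' : κ × Finset (Fin n) × Finset (Fin n) → E →L[ℝ] ((Fin n → ℂ) →L[ℂ] (Fin n → ℂ)) :=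
    fun q => LinearMap.toContinuousLinearMap
      (((blockMap q.2.1 q.2.2).restrictScalars ℝ) ∘ₗ Λ q.1)
  have hΛ' : ∀ q x, Λ' q x = blockMap q.2.1 q.2.2 (Λ q.1 x) := fun _ _ => rfl
  refine dimH_le_of_stratification
    (F := κ × Finset (Fin n) × Finset (Fin n) → ((Fin n → ℂ) →L[ℂ] (Fin n → ℂ)))
    S (fun x a => rankTable (Λ a x)) d fun x hx => ?_
  choose φ D hD h0 hev hker using fun q => exists_map_vanishing_of_rank_eq (Λ' q x)
  refine ⟨fun y q => φ q (Λ' q y), ContinuousLinearMap.pi fun q => (D q).comp (Λ' q), ?_, ?_, ?_⟩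
  · rw [hasStrictFDerivAt_pi]
    exact fun q => (hD q).comp x (Λ' q).hasStrictFDerivAt
  · refine (Submodule.finrank_mono ?_).trans (h x hx)
    intro X hX
    rw [Submodule.mem_iInf]
    intro a
    rw [Submodule.mem_comap, mem_stratumTangent]
    intro v w _ _ hvw
    let P := Finset.univ.filter fun i => w i ≠ 0
    let Q := Finset.univ.filter fun i => v i ≠ 0
    let q : κ × Finset (Fin n) × Finset (Fin n) := (a, P, Q)
    have hXq : D q (Λ' q X) = 0 := congrFun hX q
    have hvQ : ∀ j, v j ≠ 0 → j ∈ Q := fun j hj => by simp [Q, hj]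
    have hwP : ∀ j, w j ≠ 0 → j ∈ P := fun j hj => by simp [P, hj]
    have hv0 : Λ' q x v = 0 := by
      ext i
      rw [hΛ', blockMap_apply_of_support _ hvQ]
      split_ifs with hi
      · exact hvw.1 i (Finset.mem_filter.1 hi).2
      · rfl
    have hw0 : ∀ y, star w ⬝ᵥ Λ' q x y = 0 := fun y =>
      star_dotProduct_blockMap (hherm a x hx) hwP
        (fun j hj => hvw.2 j (Finset.mem_filter.1 hj).2) y
    have h1 := hker q _ hXq v (dotProductBilin ℂ ℂ (star w)) hv0 hw0
    change star w ⬝ᵥ blockMap P Q (Λ a X) v = 0 at h1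
    have h3 : star w ⬝ᵥ blockMap P Q (Λ a X) v = star w ⬝ᵥ (Λ a X) *ᵥ v := by
      refine Finset.sum_congr rfl fun i _ => ?_
      rw [blockMap_apply_of_support _ hvQ]
      by_cases hi : w i = 0
      · simp [hi]
      · simp [hwP i hi]
    rwa [h3] at h1
  · have hev' := fun q => (Λ' q).continuous.continuousAt.eventually (hev q)
    filter_upwards [eventually_all.2 hev'] with y hy _ hσ
    funext q
    have h1 : ∀ z, rankTable (Λ q.1 z) = rankTable (Λ q.1 x) →
        finrank ℂ (Λ' q z).range = finrank ℂ (Λ' q x).range := fun z hz => congrFun hz q.2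
    rw [hy q (h1 y (congrFun hσ q.1)), h0]

end Strata

/-! ### Test directions in the band and compressions to two vectors. -/

section Forms

open Matrix

variable {n k : ℕ}

theorem mem_bandHerm {A : Matrix (Fin n) (Fin n) ℂ} :
    A ∈ bandHerm n k ↔
      A.IsHermitian ∧ ∀ i j : Fin n, A i j ≠ 0 → ((j : ℤ) - (i : ℤ)).natAbs ≤ k := by
  rw [← bandwidth_le_iff]; rfl

theorem apply_eq_zero_of_mem_bandHerm {A : Matrix (Fin n) (Fin n) ℂ} (hA : A ∈ bandHerm n k)
    {i j : Fin n} (h : k < ((j : ℤ) - (i : ℤ)).natAbs) : A i j = 0 := by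
  by_contra h0
  exact absurd ((mem_bandHerm.1 hA).2 i j h0) (not_le.2 h)

theorem one_mem_bandHerm : (1 : Matrix (Fin n) (Fin n) ℂ) ∈ bandHerm n k := by
  refine mem_bandHerm.2 ⟨isHermitian_one, fun i j h => ?_⟩
  have : i = j := by by_contra hij; exact h (one_apply_ne hij)
  simp [this]

theorem sub_smul_one_mem_bandHerm {A : Matrix (Fin n) (Fin n) ℂ} (hA : A ∈ bandHerm n k) (s : ℝ) :
    A - s • (1 : Matrix (Fin n) (Fin n) ℂ) ∈ bandHerm n k :=
  sub_mem hA ((bandHerm n k).smul_mem s one_mem_bandHerm)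

/-- The Hermitian matrix with entries `z` at `(i, j)` and `star z` at `(j, i)`. -/
def bandUnit (i j : Fin n) : ℂ →ₗ[ℝ] Matrix (Fin n) (Fin n) ℂ where
  toFun z := Matrix.single i j z + Matrix.single j i (star z)
  map_add' z z' := by simp only [star_add, single_add]; abel
  map_smul' c z := by
    simp only [star_smul, star_trivial, RingHom.id_apply, smul_add, smul_single]

theorem bandUnit_apply (i j : Fin n) (z : ℂ) :
    bandUnit i j z = Matrix.single i j z + Matrix.single j i (star z) := rfl

theorem bandUnit_mem {i j : Fin n} (h : ((j : ℤ) - (i : ℤ)).natAbs ≤ k) (z : ℂ) :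
    bandUnit i j z ∈ bandHerm n k := by
  refine mem_bandHerm.2 ⟨?_, fun a b hab => ?_⟩
  · rw [IsHermitian, bandUnit_apply, conjTranspose_add, conjTranspose_single,
      conjTranspose_single, star_star, add_comm]
  · by_contra hlt
    apply hab
    have h1 : ¬ (i = a ∧ j = b) := by rintro ⟨rfl, rfl⟩; exact hlt h
    have h2 : ¬ (j = a ∧ i = b) := by
      rintro ⟨rfl, rfl⟩; apply hlt; rwa [← Int.natAbs_neg, neg_sub]
    rw [bandUnit_apply, Matrix.add_apply, single_apply, single_apply, if_neg h1, if_neg h2, add_zero]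

theorem star_dotProduct_bandUnit (i j : Fin n) (z : ℂ) (v w : Fin n → ℂ) :
    star w ⬝ᵥ bandUnit i j z *ᵥ v
      = star (w i) * z * v j + star (w j) * star z * v i := by
  rw [bandUnit_apply, add_mulVec, dotProduct_add, single_mulVec, single_mulVec,
    ← Pi.single, ← Pi.single]
  simp [mul_assoc]

theorem star_dotProduct_mulVec_comm {A : Matrix (Fin n) (Fin n) ℂ} (hA : A.IsHermitian)
    (v w : Fin n → ℂ) : star v ⬝ᵥ A *ᵥ w = star (star w ⬝ᵥ A *ᵥ v) := by
  rw [← star_dotProduct_star, star_star, star_mulVec, hA.eq, ← dotProduct_mulVec]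

theorem isKernelPair_self {A : Matrix (Fin n) (Fin n) ℂ} {x : Fin n → ℂ}
    (h : ∀ i, x i ≠ 0 → (A *ᵥ x) i = 0) : IsKernelPair A x x := ⟨h, h⟩

/-- The directions in `bandHerm n k` along which, to first order, the ranks of the submatrices
of `A` with rows and columns in `S` are constant. -/
noncomputable def bandTangent (k : ℕ) (A : Matrix (Fin n) (Fin n) ℂ) (S : Set (Fin n)) :
    Submodule ℝ (bandHerm n k) :=
  (stratumTangent A S).comap (bandHerm n k).subtype

theorem bandTangent_anti {A : Matrix (Fin n) (Fin n) ℂ} {S S' : Set (Fin n)} (h : S ⊆ S') :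
    bandTangent k A S' ≤ bandTangent k A S := fun _ hX v w hv hw hvw =>
  hX v w (fun i hi => h (hv i hi)) (fun i hi => h (hw i hi)) hvw

/-- The diagonal direction at `l` is invisible to vectors supported in `S`, but pairs to a nonzero
multiple of `|x l|²` with `x`. Enlarging the index set therefore costs at least one dimension. -/
theorem finrank_bandTangent_add_one_le {A : Matrix (Fin n) (Fin n) ℂ} {S S' : Set (Fin n)}
    (h : S ⊆ S') {x : Fin n → ℂ} (hx : ∀ i, x i ≠ 0 → i ∈ S')
    (hAx : ∀ i, x i ≠ 0 → (A *ᵥ x) i = 0) {l : Fin n} (hl : l ∉ S) (hxl : x l ≠ 0) :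
    finrank ℝ (bandTangent k A S') + 1 ≤ finrank ℝ (bandTangent k A S) := by
  refine Submodule.finrank_lt_finrank_of_lt (lt_of_le_of_ne (bandTangent_anti h) fun heq => ?_)
  have hX : (⟨bandUnit l l 1, bandUnit_mem (by simp) 1⟩ : bandHerm n k) ∈ bandTangent k A S := by
    intro v w hv hw _
    have h1 : v l = 0 := by by_contra h0; exact hl (hv l h0)
    change star w ⬝ᵥ bandUnit l l 1 *ᵥ v = 0
    rw [star_dotProduct_bandUnit, h1]; ring
  rw [← heq] at hX
  have h2 := hX x x hx hx (isKernelPair_self hAx)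
  change star x ⬝ᵥ bandUnit l l 1 *ᵥ x = 0 at h2
  rw [star_dotProduct_bandUnit] at h2
  have h3 : star (x l) * x l = 0 := by
    have : star (x l) * 1 * x l + star (x l) * star 1 * x l = 2 * (star (x l) * x l) := by
      simp; ring
    rw [this] at h2
    simpa using h2
  simp [hxl] at h3

/-- If the kernel of `Ψ` modulo `K` is trivial, then dimensions add up. -/
theorem finrank_add_le_of_comap_eq_bot {R V T : Type*} [Field R] [AddCommGroup V] [Module R V]
    [FiniteDimensional R V] [AddCommGroup T] [Module R T]
    (K : Submodule R V) (Ψ : T →ₗ[R] V) (h : ∀ t, Ψ t ∈ K → t = 0) :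
    finrank R K + finrank R T ≤ finrank R V := by
  have h1 : Function.Injective (K.mkQ ∘ₗ Ψ) := by
    rw [← LinearMap.ker_eq_bot, LinearMap.ker_eq_bot']
    intro t ht
    exact h t ((Submodule.Quotient.mk_eq_zero K).1 ht)
  have h2 := LinearMap.finrank_le_finrank_of_injective h1
  have h3 := K.finrank_quotient_add_finrank
  omega

theorem finrank_add_le_of_le_ker {R V T : Type*} [Field R] [AddCommGroup V] [Module R V]
    [FiniteDimensional R V] [AddCommGroup T] [Module R T]
    {K : Submodule R V} {Φ : V →ₗ[R] T} (h : K ≤ LinearMap.ker Φ) (hΦ : Function.Surjective Φ) :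
    finrank R K + finrank R T ≤ finrank R V := by
  have h1 := Φ.finrank_range_add_finrank_ker
  rw [LinearMap.range_eq_top.2 hΦ, finrank_top] at h1
  have h2 := Submodule.finrank_mono h
  omega

/-- A map to a real vector space that is not onto has range in the kernel of a functional. -/
theorem exists_dual_ne_zero_of_not_surjective {V T : Type*} [AddCommGroup V] [Module ℝ V]
    [AddCommGroup T] [Module ℝ T] {Φ : V →ₗ[ℝ] T} (h : ¬ Function.Surjective Φ) :
    ∃ f : T →ₗ[ℝ] ℝ, f ≠ 0 ∧ ∀ x, f (Φ x) = 0 := by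
  rw [← LinearMap.range_eq_top] at h
  obtain ⟨f, hf, hle⟩ := Submodule.exists_le_ker_of_lt_top _ (lt_top_iff_ne_top.2 h)
  exact ⟨f, hf, fun x => hle (LinearMap.mem_range_self Φ x)⟩

/-- Every real functional on `ℂ` is of the form `z ↦ re (γ z)`. -/
theorem exists_eq_re_mul (f : ℂ →ₗ[ℝ] ℝ) : ∃ γ : ℂ, ∀ z, f z = (γ * z).re := by
  refine ⟨⟨f 1, -f Complex.I⟩, fun z => ?_⟩
  have : z = z.re • (1 : ℂ) + z.im • Complex.I := by
    apply Complex.ext <;> simp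
  conv_lhs => rw [this]
  rw [map_add, map_smul, map_smul]
  simp only [smul_eq_mul, Complex.mul_re]
  ring

/-- The sesquilinear form of a matrix at a pair of vectors. -/
def formAt (v w : Fin n → ℂ) : Matrix (Fin n) (Fin n) ℂ →ₗ[ℝ] ℂ where
  toFun X := star v ⬝ᵥ X *ᵥ w
  map_add' X Y := by rw [add_mulVec, dotProduct_add]
  map_smul' c X := by rw [smul_mulVec, dotProduct_smul]; rfl

/-- The compression of a Hermitian band matrix to the span of `v` and `w`. -/
noncomputable def compression (k : ℕ) (v w : Fin n → ℂ) : bandHerm n k →ₗ[ℝ] ℝ × ℝ × ℂ :=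
  ((Complex.reLm ∘ₗ formAt v v).prod ((Complex.reLm ∘ₗ formAt w w).prod (formAt v w))) ∘ₗ
    (bandHerm n k).subtype

theorem compression_apply (v w : Fin n → ℂ) (X : bandHerm n k) :
    compression k v w X
      = ((star v ⬝ᵥ X.1 *ᵥ v).re, (star w ⬝ᵥ X.1 *ᵥ w).re, star v ⬝ᵥ X.1 *ᵥ w) := rfl

/-- Orthonormal pairs of vectors. -/
def IsOrthonormalPair (v w : Fin n → ℂ) : Prop :=
  star v ⬝ᵥ v = 1 ∧ star w ⬝ᵥ w = 1 ∧ star v ⬝ᵥ w = 0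

theorem finrank_bandTangent_add_four_le {A : Matrix (Fin n) (Fin n) ℂ} {S : Set (Fin n)}
    {v w : Fin n → ℂ} (hv : ∀ i, v i ≠ 0 → i ∈ S) (hw : ∀ i, w i ≠ 0 → i ∈ S)
    (hAv : ∀ i ∈ S, (A *ᵥ v) i = 0) (hAw : ∀ i ∈ S, (A *ᵥ w) i = 0)
    (h : Function.Surjective (compression k v w)) :
    finrank ℝ (bandTangent k A S) + 4 ≤ finrank ℝ (bandHerm n k) := by
  have hfr : finrank ℝ (ℝ × ℝ × ℂ) = 4 := by simp
  rw [← hfr]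
  refine finrank_add_le_of_le_ker (fun X hX => ?_) h
  have h1 := hX v v hv hv ⟨fun i hi => hAv i (hv i hi), fun i hi => hAv i (hv i hi)⟩
  have h2 := hX w w hw hw ⟨fun i hi => hAw i (hw i hi), fun i hi => hAw i (hw i hi)⟩
  have h3 := hX w v hw hv ⟨fun i hi => hAw i (hv i hi), fun i hi => hAv i (hw i hi)⟩
  simp only [Submodule.subtype_apply] at h1 h2 h3
  rw [LinearMap.mem_ker, compression_apply, h1, h2, h3]
  simp

/-- A functional vanishing on the image is a nonzero Hermitian 2×2 matrix. Testing it on the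
identity shows that it is traceless, hence invertible; testing it on single band entries shows that
its form vanishes on the pairs `(v a, w a)`, `(v b, w b)` with `a`, `b` within the band. -/
theorem mul_eq_mul_of_not_surjective_compression {v w : Fin n → ℂ} (hvw : IsOrthonormalPair v w)
    (h : ¬ Function.Surjective (compression k v w)) {i j : Fin n}
    (hij : ((j : ℤ) - (i : ℤ)).natAbs ≤ k) : v i * w j = v j * w i := by
  obtain ⟨f, hf, hf0⟩ := exists_dual_ne_zero_of_not_surjective h
  obtain ⟨γ, hγ⟩ := exists_eq_re_mul (f ∘ₗ LinearMap.inr ℝ ℝ (ℝ × ℂ) ∘ₗ LinearMap.inr ℝ ℝ ℂ)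
  set α := f (1, 0, 0) with hα
  set β := f (0, 1, 0) with hβ
  have hfa : ∀ a b c, f (a, b, c) = a * α + b * β + (γ * c).re := by
    intro a b c
    have : ((a, b, c) : ℝ × ℝ × ℂ) = a • (1, 0, 0) + b • (0, 1, 0) + (0, 0, c) := by simp
    rw [this, map_add, map_add, map_smul, map_smul, ← hγ c]
    rfl
  have hαβ : β = -α := by
    have := hf0 ⟨1, one_mem_bandHerm⟩
    rw [compression_apply, hfa] at this
    simp only [one_mulVec, hvw.1, hvw.2.1, hvw.2.2] at this
    simp at this
    linarith
  have hne : ¬ (α = 0 ∧ γ = 0) := by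
    rintro ⟨h1, h2⟩
    apply hf
    ext1
    · ext1; exact h1
    · ext1
      · ext1; exact hαβ.trans (by rw [h1, neg_zero]; rfl)
      · ext1 z; simpa [h1, h2] using hfa 0 0 z
  have hform : ∀ a b : Fin n, ((b : ℤ) - (a : ℤ)).natAbs ≤ k →
      2 * α * (star (v a) * v b - star (w a) * w b) + γ * (star (v a) * w b)
        + star γ * (star (w a) * v b) = 0 := by
    intro a b hab
    set q := 2 * α * (star (v a) * v b - star (w a) * w b) + γ * (star (v a) * w b)
        + star γ * (star (w a) * v b) with hq
    have hz : ∀ z : ℂ, (q * z).re = 0 := by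
      intro z
      have := hf0 ⟨bandUnit a b z, bandUnit_mem hab z⟩
      rw [compression_apply, hfa, star_dotProduct_bandUnit, star_dotProduct_bandUnit,
        star_dotProduct_bandUnit, hαβ] at this
      rw [← this, hq]
      simp only [Complex.mul_re, Complex.add_re, Complex.sub_re, Complex.mul_im, Complex.add_im,
        Complex.sub_im, Complex.star_def, Complex.conj_re, Complex.conj_im, Complex.ofReal_re,
        Complex.ofReal_im, Complex.re_ofNat, Complex.im_ofNat]
      ring
    have h1 := hz (star q)
    have : q * star q = (Complex.normSq q : ℂ) := Complex.mul_conj q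
    rw [this, Complex.ofReal_re, Complex.normSq_eq_zero] at h1
    exact h1
  have e1 := hform i i (by simp)
  have e2 := hform i j hij
  -- The row `(r₁, r₂)` is the 2×2 matrix applied to the conjugate of `(v i, w i)`. It annihilates
  -- `(v i, w i)` and `(v j, w j)`, which are thus dependent if it is nonzero; if it is zero,
  -- invertibility (`hpos`) gives `v i = w i = 0`.
  set r₁ := 2 * α * star (v i) + star γ * star (w i) with hr₁
  set r₂ := γ * star (v i) - 2 * α * star (w i) with hr₂
  have e1' : r₁ * v i + r₂ * w i = 0 := by rw [← e1]; ring
  have e2' : r₁ * v j + r₂ * w j = 0 := by rw [← e2]; ring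
  have hpos : (2 * α * (2 * α) + γ * star γ : ℂ) ≠ 0 := by
    have : (2 * α * (2 * α) + γ * star γ : ℂ) = ((4 * α ^ 2 + Complex.normSq γ : ℝ) : ℂ) := by
      rw [Complex.star_def, Complex.mul_conj]; push_cast; ring
    rw [this, Complex.ofReal_ne_zero]
    intro h0
    have h1 := Complex.normSq_nonneg γ
    have h2 := sq_nonneg α
    refine hne ⟨?_, ?_⟩
    · exact pow_eq_zero_iff (two_ne_zero) |>.1 (by linarith)
    · exact Complex.normSq_eq_zero.1 (by linarith)
  by_cases hr1 : r₁ = 0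
  · by_cases hr2 : r₂ = 0
    · have h1 : (2 * α * (2 * α) + γ * star γ : ℂ) * star (v i) = 0 := by
        have : (2 * α * (2 * α) + γ * star γ : ℂ) * star (v i) = 2 * α * r₁ + star γ * r₂ := by
          rw [hr₁, hr₂]; ring
        rw [this, hr1, hr2]; ring
      have h2 : (2 * α * (2 * α) + γ * star γ : ℂ) * star (w i) = 0 := by
        have : (2 * α * (2 * α) + γ * star γ : ℂ) * star (w i) = γ * r₁ - 2 * α * r₂ := by
          rw [hr₁, hr₂]; ring
        rw [this, hr1, hr2]; ring
      have h3 : v i = 0 := star_eq_zero.1 ((mul_eq_zero.1 h1).resolve_left hpos)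
      have h4 : w i = 0 := star_eq_zero.1 ((mul_eq_zero.1 h2).resolve_left hpos)
      rw [h3, h4]; ring
    · have : r₂ * (v i * w j - v j * w i) = 0 := by
        linear_combination v i * e2' - v j * e1'
      exact sub_eq_zero.1 ((mul_eq_zero.1 this).resolve_left hr2)
  · have : r₁ * (v i * w j - v j * w i) = 0 := by
      linear_combination w j * e1' - w i * e2'
    exact sub_eq_zero.1 ((mul_eq_zero.1 this).resolve_left hr1)

end Forms

/-! ### Kernels of principal submatrices, and gaps in their vectors. -/

section KernelPairs

open Matrix

variable {n k : ℕ}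

theorem exists_orthonormal_of_le_finrank {m : ℕ} {K : Submodule ℂ (Fin n → ℂ)}
    (h : m ≤ finrank ℂ K) :
    ∃ e : Fin m → (Fin n → ℂ), (∀ a, e a ∈ K) ∧
      ∀ a b, star (e a) ⬝ᵥ e b = if a = b then 1 else 0 := by
  let L := WithLp.linearEquiv 2 ℂ (Fin n → ℂ)
  let K' : Submodule ℂ (EuclideanSpace ℂ (Fin n)) := K.comap L.toLinearMap
  have hK' : finrank ℂ K' = finrank ℂ K := by
    have : K' = K.map L.symm.toLinearMap := (Submodule.map_equiv_eq_comap_symm L.symm K).symm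
    rw [this]
    exact LinearEquiv.finrank_map_eq L.symm K
  let b := stdOrthonormalBasis ℂ K'
  have hb := b.orthonormal
  rw [orthonormal_iff_ite] at hb
  refine ⟨fun a => L (b (Fin.castLE (hK' ▸ h) a)), fun a => (b (Fin.castLE (hK' ▸ h) a)).2,
    fun a c => ?_⟩
  have h1 := hb (Fin.castLE (hK' ▸ h) a) (Fin.castLE (hK' ▸ h) c)
  rw [Submodule.coe_inner, EuclideanSpace.inner_eq_star_dotProduct, dotProduct_comm] at h1
  simpa [L] using h1

theorem exists_isOrthonormalPair_or (K : Submodule ℂ (Fin n → ℂ)) :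
    (∃ v ∈ K, ∃ w ∈ K, IsOrthonormalPair v w) ∨
      ∀ u ∈ K, u ≠ 0 → ∀ z ∈ K, ∃ c : ℂ, z = c • u := by
  by_cases h : 2 ≤ finrank ℂ K
  · obtain ⟨e, he, heo⟩ := exists_orthonormal_of_le_finrank h
    exact Or.inl ⟨e 0, he 0, e 1, he 1, by simp [heo], by simp [heo], by simp [heo]⟩
  · refine Or.inr fun u hu hu0 z hz => ?_
    have h1 : finrank ℂ K ≤ 1 := by omega
    obtain ⟨g, hg⟩ := finrank_le_one_iff.1 h1
    obtain ⟨a, ha⟩ := hg ⟨u, hu⟩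
    obtain ⟨b, hb⟩ := hg ⟨z, hz⟩
    have ha' : a • g.1 = u := congrArg Subtype.val ha
    have hb' : b • g.1 = z := congrArg Subtype.val hb
    have ha0 : a ≠ 0 := by rintro rfl; apply hu0; rw [← ha', zero_smul]
    exact ⟨b / a, by rw [← ha', ← hb', smul_smul, div_mul_cancel₀ _ ha0]⟩

/-- The vectors supported in `S` that `A` maps to vectors vanishing on `S`. -/
def kernelOn (A : Matrix (Fin n) (Fin n) ℂ) (S : Set (Fin n)) : Submodule ℂ (Fin n → ℂ) where
  carrier := {v | (∀ i, v i ≠ 0 → i ∈ S) ∧ ∀ i ∈ S, (A *ᵥ v) i = 0}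
  zero_mem' := by simp
  add_mem' := by
    rintro v w ⟨hv, hv'⟩ ⟨hw, hw'⟩
    refine ⟨fun i hi => ?_, fun i hi => by rw [mulVec_add, Pi.add_apply, hv' i hi, hw' i hi,
      add_zero]⟩
    by_contra hS
    exact hi (by rw [Pi.add_apply, not_not.1 (mt (hv i) hS), not_not.1 (mt (hw i) hS), add_zero])
  smul_mem' := by
    rintro c v ⟨hv, hv'⟩
    refine ⟨fun i hi => hv i fun h0 => hi (by simp [h0]), fun i hi => ?_⟩
    rw [mulVec_smul, Pi.smul_apply, hv' i hi, smul_zero]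

open scoped ComplexOrder in
/-- Solvability of the linear system with the principal submatrix on `S` as its matrix and the
negated part on `S` of the `g`-th column as its right hand side. -/
theorem exists_solution_of_kernelOn {A : Matrix (Fin n) (Fin n) ℂ} (hA : A.IsHermitian)
    {S : Set (Fin n)} {g : Fin n} (hg : g ∉ S) (h : ∀ z ∈ kernelOn A S, (A *ᵥ z) g = 0) :
    ∃ w : Fin n → ℂ, w g = 1 ∧ (∀ i, w i ≠ 0 → i = g ∨ i ∈ S) ∧ ∀ i ∈ S, (A *ᵥ w) i = 0 := by
  classical
  -- The principal submatrix on `S`, padded by the identity. Padding keeps it Hermitian and forces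
  -- its kernel vectors to be supported in `S`, so the Fredholm alternative for `T` is the one for
  -- the submatrix.
  let T : Matrix (Fin n) (Fin n) ℂ := Matrix.of fun i j =>
    if i ∈ S ∧ j ∈ S then A i j else if i = j then 1 else 0
  have hT : T.IsHermitian := by
    ext i j
    simp only [conjTranspose_apply, T, of_apply]
    by_cases h1 : i ∈ S ∧ j ∈ S
    · rw [if_pos h1, if_pos h1.symm, hA.apply]
    · rw [if_neg h1, if_neg (fun h2 => h1 h2.symm)]
      by_cases h2 : i = j
      · simp [h2]
      · simp [h2, Ne.symm h2]
  have hTS : ∀ x : Fin n → ℂ, (∀ i, x i ≠ 0 → i ∈ S) → ∀ i ∈ S, (T *ᵥ x) i = (A *ᵥ x) i := by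
    intro x hx i hi
    rw [mulVec, mulVec, dotProduct, dotProduct]
    refine Finset.sum_congr rfl fun j _ => ?_
    by_cases hj : x j = 0
    · simp [hj]
    · simp [T, hi, hx j hj]
  have hTn : ∀ x : Fin n → ℂ, ∀ i, i ∉ S → (T *ᵥ x) i = x i := by
    intro x i hi
    simp [mulVec, dotProduct, T, hi]
  let b : Fin n → ℂ := fun i => if i ∈ S then - A i g else 0
  have hb : b ∈ LinearMap.range (Matrix.toLin' T) := by
    by_contra hb
    obtain ⟨f, hfb, hf⟩ := Submodule.exists_le_ker_of_notMem hb
    let z : Fin n → ℂ := fun i => star (f (Pi.single i 1))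
    have hfz : ∀ x, f x = star z ⬝ᵥ x := by
      intro x
      conv_lhs => rw [← Finset.univ_sum_single x]
      rw [map_sum]
      refine Finset.sum_congr rfl fun i _ => ?_
      have : (Pi.single i (x i) : Fin n → ℂ) = x i • Pi.single i 1 := by
        rw [← Pi.single_smul, smul_eq_mul, mul_one]
      rw [this, map_smul]
      simp [z, mul_comm]
    have hTz : T *ᵥ z = 0 := by
      have h1 : ∀ x, star z ⬝ᵥ T *ᵥ x = 0 := fun x => by
        rw [← hfz]; exact hf (LinearMap.mem_range_self (Matrix.toLin' T) x)
      have h2 := h1 (T *ᵥ z)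
      rw [dotProduct_mulVec, ← hT.eq, ← star_mulVec, hT.eq] at h2
      exact dotProduct_star_self_eq_zero.1 h2
    have hzS : ∀ i, z i ≠ 0 → i ∈ S := by
      intro i hi
      by_contra hiS
      exact hi ((hTn z i hiS).symm.trans (congrFun hTz i))
    have hzK : z ∈ kernelOn A S := ⟨hzS, fun i hi => by rw [← hTS z hzS i hi, hTz]; rfl⟩
    apply hfb
    rw [hfz]
    have h3 := congrArg star (h z hzK)
    rw [star_zero, mulVec, dotProduct, star_sum] at h3
    rw [← neg_eq_zero, ← h3, dotProduct, ← Finset.sum_neg_distrib]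
    refine Finset.sum_congr rfl fun i _ => ?_
    by_cases hi : z i = 0
    · simp [hi]
    · simp only [b, hzS i hi, if_true, star_mul', hA.apply i g, Pi.star_apply]
      ring
  obtain ⟨y, hy⟩ := hb
  rw [toLin'_apply] at hy
  have hyS : ∀ i, y i ≠ 0 → i ∈ S := by
    intro i hi
    by_contra hiS
    exact hi ((hTn y i hiS).symm.trans ((congrFun hy i).trans (by simp [b, hiS])))
  have hyg : y g = 0 := by by_contra h0; exact hg (hyS g h0)
  refine ⟨y + Pi.single g 1, by simp [hyg], fun i hi => ?_, fun i hi => ?_⟩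
  · by_contra hcon
    push Not at hcon
    apply hi
    rw [Pi.add_apply, Pi.single_eq_of_ne hcon.1, add_zero]
    by_contra h0
    exact hcon.2 (hyS i h0)
  · rw [mulVec_add, Pi.add_apply, ← hTS y hyS i hi, hy]
    simp [b, hi]

/-- If two independent vectors are proportional on every pair of indices at distance at most `k`,
then they both vanish on at least `k` consecutive indices, between the index `j` where the support
of some combination `u` of them starts, and an earlier index `l`. -/
theorem exists_gap {v w : Fin n → ℂ} (hvw : IsOrthonormalPair v w)
    (h : ∀ i j : Fin n, ((j : ℤ) - (i : ℤ)).natAbs ≤ k → v i * w j = v j * w i) :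
    ∃ (l j : Fin n) (u x : Fin n → ℂ), u ∈ Submodule.span ℂ {v, w} ∧ x ∈ Submodule.span ℂ {v, w} ∧
      (l : ℕ) + k < j ∧ x l ≠ 0 ∧ u j ≠ 0 ∧ (∀ i < j, u i = 0) ∧
      ∀ i, l < i → i < j → x i = 0 := by
  classical
  have hv0 : v ≠ 0 := by rintro rfl; simpa using hvw.1
  let p : Fin n → Prop := fun i => v i ≠ 0 ∨ w i ≠ 0
  have hp : ∃ i, p i := by
    obtain ⟨i, hi⟩ := Function.ne_iff.1 hv0
    exact ⟨i, Or.inl hi⟩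
  obtain ⟨j₁, hj₁, hj₁min⟩ : ∃ i, p i ∧ ∀ i' < i, ¬ p i' := by
    obtain ⟨i, hi, hmin⟩ := WellFounded.has_min (wellFounded_lt (α := Fin n)) {i | p i} hp
    exact ⟨i, hi, fun i' hlt hi' => hmin i' hi' hlt⟩
  -- The combination that vanishes at the first index `j₁` of the joint support; its own support
  -- therefore starts strictly later.
  let u : Fin n → ℂ := w j₁ • v - v j₁ • w
  have hu : u ∈ Submodule.span ℂ {v, w} :=
    sub_mem (Submodule.smul_mem _ _ (Submodule.subset_span (by simp)))
      (Submodule.smul_mem _ _ (Submodule.subset_span (by simp)))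
  have hu0 : ∃ i, u i ≠ 0 := by
    refine Function.ne_iff.1 (?_ : u ≠ 0)
    intro h0
    have e1 : star v ⬝ᵥ u = w j₁ := by
      rw [dotProduct_sub, dotProduct_smul, dotProduct_smul, hvw.1, hvw.2.2]; simp
    have e2 : star w ⬝ᵥ u = - v j₁ := by
      have h3 : star w ⬝ᵥ v = 0 := by
        have := congrArg star hvw.2.2
        rwa [← star_dotProduct_star, star_star, star_zero] at this
      rw [dotProduct_sub, dotProduct_smul, dotProduct_smul, hvw.2.1, h3]; simp
    rw [h0, dotProduct_zero] at e1 e2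
    rcases hj₁ with h1 | h1
    · exact h1 (neg_eq_zero.1 e2.symm)
    · exact h1 e1.symm
  obtain ⟨j, hj, hjmin⟩ : ∃ j, u j ≠ 0 ∧ ∀ i < j, u i = 0 := by
    obtain ⟨i, hi, hmin⟩ := WellFounded.has_min (wellFounded_lt (α := Fin n)) {i | u i ≠ 0} hu0
    exact ⟨i, hi, fun i' hlt => by by_contra hi'; exact hmin i' hi' hlt⟩
  have huapp : ∀ i, u i = w j₁ * v i - v j₁ * w i := fun i => rfl
  have hj₁j : j₁ < j := by
    rcases lt_trichotomy j₁ j with hlt | heq | hgt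
    · exact hlt
    · exfalso; apply hj; rw [huapp, heq]; ring
    · exfalso
      have := hj₁min j hgt
      simp only [p, not_or, not_not] at this
      apply hj; rw [huapp, this.1, this.2]; ring
  obtain ⟨l, ⟨hl, hlj⟩, hlmax⟩ : ∃ l, (p l ∧ l < j) ∧ ∀ i, l < i → ¬ (p i ∧ i < j) := by
    obtain ⟨i, hi, hmax⟩ := WellFounded.has_min (wellFounded_gt (α := Fin n)) {i | p i ∧ i < j}
      ⟨j₁, hj₁, hj₁j⟩
    exact ⟨i, hi, fun i' hlt hi' => hmax i' hi' hlt⟩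
  -- Since `u l = 0`, the pair `(v l, w l)` is a nonzero multiple of `(v j₁, w j₁)`. If `l` and `j`
  -- were within distance `k`, then `(v j, w j)` would be proportional to it too, and `u j` would
  -- vanish.
  have hgap : (l : ℕ) + k < j := by
    by_contra hle
    have hlj' : (l : ℕ) < j := hlj
    have e1 := h l j (by omega)
    have e2 : w j₁ * v l = v j₁ * w l := sub_eq_zero.1 ((huapp l).symm.trans (hjmin l hlj))
    apply hj
    rcases hl with h1 | h1
    · apply (mul_eq_zero.1 (_ : v l * u j = 0)).resolve_left h1
      rw [huapp]; linear_combination v j * e2 - v j₁ * e1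
    · apply (mul_eq_zero.1 (_ : w l * u j = 0)).resolve_left h1
      rw [huapp]; linear_combination w j * e2 - w j₁ * e1
  have hz : ∀ i, l < i → i < j → v i = 0 ∧ w i = 0 := by
    intro i h1 h2
    have := hlmax i h1
    simp only [p] at this
    tauto
  rcases hl with h1 | h1
  · exact ⟨l, j, u, v, hu, Submodule.subset_span (by simp), hgap, h1, hj, hjmin,
      fun i a b => (hz i a b).1⟩
  · exact ⟨l, j, u, w, hu, Submodule.subset_span (by simp), hgap, h1, hj, hjmin,
      fun i a b => (hz i a b).2⟩

end KernelPairs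

/-! ### Codimension of the nontransversal matrices. -/

section Codimension

open Matrix

variable {n k : ℕ}

theorem mulVec_apply_eq_zero_of_mem_bandHerm {A : Matrix (Fin n) (Fin n) ℂ}
    (hA : A ∈ bandHerm n k) {x : Fin n → ℂ} {i : Fin n}
    (h : ∀ j, x j ≠ 0 → k < ((j : ℤ) - (i : ℤ)).natAbs) : (A *ᵥ x) i = 0 := by
  rw [mulVec, dotProduct]
  refine Finset.sum_eq_zero fun j _ => ?_
  by_cases hj : x j = 0
  · rw [hj, mul_zero]
  · rw [apply_eq_zero_of_mem_bandHerm hA (h j hj), zero_mul]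

theorem eq_zero_of_support {x : Fin n → ℂ} {S : Set (Fin n)} (hx : ∀ i, x i ≠ 0 → i ∈ S)
    {i : Fin n} (hi : i ∉ S) : x i = 0 := by
  by_contra h0
  exact hi (hx i h0)

/-- Independence of the four functionals coming from kernel vectors `x` and `u` with separated
supports and their extensions `y` and `w` by one more index. -/
theorem finrank_bandTangent_add_six_le {A : Matrix (Fin n) (Fin n) ℂ} {S : Set (Fin n)}
    {u w x y : Fin n → ℂ} {l g' g j : Fin n}
    (hu : ∀ i, u i ≠ 0 → i ∈ S) (hw : ∀ i, w i ≠ 0 → i ∈ S)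
    (hx : ∀ i, x i ≠ 0 → i ∈ S) (hy : ∀ i, y i ≠ 0 → i ∈ S)
    (hgj : ((j : ℤ) - (g : ℤ)).natAbs ≤ k) (hlg : ((l : ℤ) - (g' : ℤ)).natAbs ≤ k)
    (huu : IsKernelPair A u u) (hxx : IsKernelPair A x x) (huw : IsKernelPair A u w)
    (hxy : IsKernelPair A x y)
    (huj : u j ≠ 0) (hug : u g = 0) (hul : u l = 0)
    (hxl : x l ≠ 0) (hxj : x j = 0) (hxg : x g' = 0)
    (hwg : w g = 1) (hwl : w l = 0) (hyg : y g' = 1) (hyj : y j = 0) :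
    finrank ℝ (bandTangent k A S) + 6 ≤ finrank ℝ (bandHerm n k) := by
  -- Six test directions at the entries `(j, j)`, `(l, l)`, `(g, j)`, `(g', l)`, to be separated by
  -- the conditions from `(u, u)`, `(x, x)`, `(u, w)`, `(x, y)`. The indices `g` and `g'` may
  -- coincide.
  let Ψ : ℝ × ℝ × ℂ × ℂ →ₗ[ℝ] bandHerm n k := LinearMap.codRestrict (bandHerm n k)
    ((bandUnit j j ∘ₗ Complex.ofRealLI.toLinearMap).coprod
      ((bandUnit l l ∘ₗ Complex.ofRealLI.toLinearMap).coprod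
        ((bandUnit g j).coprod (bandUnit g' l))))
    (fun t => add_mem (bandUnit_mem (by simp) _) (add_mem (bandUnit_mem (by simp) _)
      (add_mem (bandUnit_mem hgj _) (bandUnit_mem hlg _))))
  have hΨ : ∀ a b z z' (p q : Fin n → ℂ), star q ⬝ᵥ (Ψ (a, b, z, z')).1 *ᵥ p
      = (star (q j) * a * p j + star (q j) * star (a : ℂ) * p j)
        + ((star (q l) * b * p l + star (q l) * star (b : ℂ) * p l)
        + ((star (q g) * z * p j + star (q j) * star z * p g)
        + (star (q g') * z' * p l + star (q l) * star z' * p g'))) := by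
    intro a b z z' p q
    rw [← star_dotProduct_bandUnit, ← star_dotProduct_bandUnit, ← star_dotProduct_bandUnit,
      ← star_dotProduct_bandUnit, ← dotProduct_add, ← dotProduct_add, ← dotProduct_add,
      ← add_mulVec, ← add_mulVec, ← add_mulVec]
    rfl
  have hfr : finrank ℝ (ℝ × ℝ × ℂ × ℂ) = 6 := by simp
  rw [← hfr]
  refine finrank_add_le_of_comap_eq_bot _ Ψ ?_
  rintro ⟨a, b, z, z'⟩ hmem
  have h1 := hmem u u hu hu huu
  have h2 := hmem x x hx hx hxx
  have h3 := hmem u w hu hw huw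
  have h4 := hmem x y hx hy hxy
  simp only [Submodule.subtype_apply] at h1 h2 h3 h4
  rw [hΨ] at h1 h2 h3 h4
  simp only [hug, hul, hxj, hxg, hwg, hwl, hyg, hyj, star_zero, star_one, zero_mul, mul_zero,
    add_zero, zero_add, one_mul, Complex.star_def, Complex.conj_ofReal] at h1 h2 h3 h4
  -- The diagonal coefficients go first: `w j` and `y l` are arbitrary, so `h3` and `h4` isolate `z`
  -- and `z'` only once `a = b = 0`.
  have ha : a = 0 := by
    have : 2 * (starRingEnd ℂ (u j) * u j) * (a : ℂ) = 0 := by rw [← h1]; ring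
    simpa [huj] using this
  have hb : b = 0 := by
    have : 2 * (starRingEnd ℂ (x l) * x l) * (b : ℂ) = 0 := by rw [← h2]; ring
    simpa [hxl] using this
  subst ha hb
  simp only [Complex.ofReal_zero, mul_zero, zero_mul, add_zero, zero_add] at h3 h4
  rw [(mul_eq_zero.1 h3).resolve_right huj, (mul_eq_zero.1 h4).resolve_right hxl]
  rfl

/-- The codimension estimate for the kernel of corank two. -/
theorem finrank_bandTangent_of_isOrthonormalPair (hk : 0 < k) {A : Matrix (Fin n) (Fin n) ℂ}
    (hA : A ∈ bandHerm n k) (m : ℕ) : ∀ (a b : ℕ), b + 1 ≤ a + m →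
    ∀ v ∈ kernelOn A {i | a ≤ (i : ℕ) ∧ (i : ℕ) ≤ b},
    ∀ w ∈ kernelOn A {i | a ≤ (i : ℕ) ∧ (i : ℕ) ≤ b}, IsOrthonormalPair v w →
      finrank ℝ (bandTangent k A {i | a ≤ (i : ℕ) ∧ (i : ℕ) ≤ b}) + 4
          ≤ finrank ℝ (bandHerm n k) ∧
      (¬ Function.Surjective (compression k v w) →
        finrank ℝ (bandTangent k A {i | a ≤ (i : ℕ) ∧ (i : ℕ) ≤ b}) + 5
          ≤ finrank ℝ (bandHerm n k)) := by
  induction m with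
  | zero =>
    intro a b hab v hv w _ hvw
    exfalso
    have : v = 0 := by
      ext i
      by_contra h0
      have := hv.1 i h0
      simp only [Set.mem_ofPred_eq] at this
      omega
    rw [this] at hvw
    simpa using hvw.1
  | succ m ih =>
    intro a b hab v hv w hw hvw
    suffices h5 : ¬ Function.Surjective (compression k v w) →
        finrank ℝ (bandTangent k A {i | a ≤ (i : ℕ) ∧ (i : ℕ) ≤ b}) + 5
          ≤ finrank ℝ (bandHerm n k) by
      refine ⟨?_, h5⟩
      by_cases hs : Function.Surjective (compression k v w)
      · exact finrank_bandTangent_add_four_le hv.1 hw.1 hv.2 hw.2 hs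
      · exact le_trans (by omega) (h5 hs)
    intro hns
    obtain ⟨l, j, u, x', hu, hx', hlj, hxl, huj, huz, hxz⟩ := exists_gap hvw
      (fun i j hij => mul_eq_mul_of_not_surjective_compression hvw hns hij)
    set S : Set (Fin n) := {i | a ≤ (i : ℕ) ∧ (i : ℕ) ≤ b} with hS
    have hspan : Submodule.span ℂ {v, w} ≤ kernelOn A S := by
      rw [Submodule.span_le]
      rintro z (rfl | rfl)
      · exact hv
      · exact hw
    have huS := hspan hu
    have hx'S := hspan hx'
    have hlS : l ∈ S := hx'S.1 l hxl
    have hjS : j ∈ S := huS.1 j huj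
    simp only [hS, Set.mem_ofPred_eq] at hlS hjS
    set R : Set (Fin n) := {i | (j : ℕ) ≤ i ∧ (i : ℕ) ≤ b} with hR
    set L : Set (Fin n) := {i | a ≤ (i : ℕ) ∧ (i : ℕ) ≤ l} with hL
    have hRS : R ⊆ S := fun i hi => ⟨by have := hi.1; omega, hi.2⟩
    have hLS : L ⊆ S := fun i hi => ⟨hi.1, by have := hi.2; omega⟩
    have huR : ∀ i, u i ≠ 0 → i ∈ R := by
      intro i hi
      refine ⟨?_, (huS.1 i hi).2⟩
      by_contra hlt
      exact hi (huz i (by rw [Fin.lt_def]; omega))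
    -- Cut `x'` at the gap into `x` on `L` and `r` on `R`. Because `l + k < j`, the band matrix does
    -- not couple `L` and `R`, so each piece is a kernel vector of its own block.
    let x : Fin n → ℂ := fun i => if i ≤ l then x' i else 0
    let r : Fin n → ℂ := fun i => if i ≤ l then 0 else x' i
    have hxr : x' = x + r := by
      ext i; by_cases h : i ≤ l <;> simp [x, r, h]
    have hxL : ∀ i, x i ≠ 0 → i ∈ L := by
      intro i hi
      by_cases h : i ≤ l
      · have : x i = x' i := by simp [x, h]
        rw [this] at hi
        exact ⟨(hx'S.1 i hi).1, h⟩
      · simp [x, h] at hi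
    have hrR : ∀ i, r i ≠ 0 → i ∈ R := by
      intro i hi
      by_cases h : i ≤ l
      · simp [r, h] at hi
      · have : r i = x' i := by simp [r, h]
        rw [this] at hi
        refine ⟨?_, (hx'S.1 i hi).2⟩
        by_contra hlt
        exact hi (hxz i (not_le.1 h) (by rw [Fin.lt_def]; omega))
    have hxl' : x l ≠ 0 := by simpa [x] using hxl
    have hAadd : ∀ i, (A *ᵥ x') i = (A *ᵥ x) i + (A *ᵥ r) i := by
      intro i; rw [hxr, mulVec_add, Pi.add_apply]
    have hAxR : ∀ i : Fin n, (j : ℕ) ≤ i → (A *ᵥ x) i = 0 := by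
      intro i hi
      refine mulVec_apply_eq_zero_of_mem_bandHerm hA fun i' hi' => ?_
      have := (hxL i' hi').2
      omega
    have hArL : ∀ i : Fin n, (i : ℕ) ≤ l → (A *ᵥ r) i = 0 := by
      intro i hi
      refine mulVec_apply_eq_zero_of_mem_bandHerm hA fun i' hi' => ?_
      have := (hrR i' hi').1
      omega
    have hxK : x ∈ kernelOn A L := by
      refine ⟨hxL, fun i hi => ?_⟩
      have h1 := hx'S.2 i (hLS hi)
      rwa [hAadd, hArL i hi.2, add_zero] at h1
    have hrK : r ∈ kernelOn A R := by
      refine ⟨hrR, fun i hi => ?_⟩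
      have h1 := hx'S.2 i (hRS hi)
      rwa [hAadd, hAxR i hi.1, zero_add] at h1
    have huK : u ∈ kernelOn A R := ⟨huR, fun i hi => huS.2 i (hRS hi)⟩
    have hu0 : u ≠ 0 := by rintro h; exact huj (congrFun h j)
    have hx0 : x ≠ 0 := by rintro h; exact hxl' (congrFun h l)
    have hlR : l ∉ R := fun h => by have := h.1; omega
    have hjL : j ∉ L := fun h => by have := h.2; omega
    -- A block with at least two-dimensional kernel supplies four conditions by induction, and the
    -- kernel vector of the other block supplies a fifth. Otherwise both kernels are lines, spanned
    -- by `u` and `x`.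
    rcases exists_isOrthonormalPair_or (kernelOn A R) with ⟨v₁, hv₁, w₁, hw₁, h1⟩ | hR1
    · have h2 := (ih j b (by omega) v₁ hv₁ w₁ hw₁ h1).1
      rw [← hR] at h2
      have h3 := finrank_bandTangent_add_one_le (k := k) hRS (fun i hi => hLS (hxL i hi))
        (fun i hi => hxK.2 i (hxL i hi)) hlR hxl'
      omega
    rcases exists_isOrthonormalPair_or (kernelOn A L) with ⟨v₁, hv₁, w₁, hw₁, h1⟩ | hL1
    · have h2 := (ih a l (by omega) v₁ hv₁ w₁ hw₁ h1).1
      rw [← hL] at h2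
      have h3 := finrank_bandTangent_add_one_le (k := k) hLS (fun i hi => hRS (huR i hi))
        (fun i hi => huK.2 i (huR i hi)) hjL huj
      omega
    have hjn := j.2
    -- The gap indices next to the blocks `R` and `L`; `0 < k` places them strictly between `l` and
    -- `j` and within the band of `j` and `l`.
    let g : Fin n := ⟨j - 1, by omega⟩
    let g' : Fin n := ⟨l + 1, by omega⟩
    have hgv : (g : ℕ) = j - 1 := rfl
    have hgv' : (g' : ℕ) = l + 1 := rfl
    have hgS : g ∈ S := ⟨by omega, by omega⟩
    have hgS' : g' ∈ S := ⟨by omega, by omega⟩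
    have hgR : g ∉ R := fun h => by have := h.1; omega
    have hgL : g' ∉ L := fun h => by have := h.2; omega
    have hAug : (A *ᵥ u) g = 0 := huS.2 g hgS
    -- The row `g'` may see both blocks, but `r` is a multiple of `u`, and `A *ᵥ u` vanishes on all
    -- of `S`.
    have hAxg : (A *ᵥ x) g' = 0 := by
      obtain ⟨c, hc⟩ := hR1 u huK hu0 r hrK
      have h1 := hx'S.2 g' hgS'
      rw [hAadd, hc, mulVec_smul, Pi.smul_apply, huS.2 g' hgS', smul_zero, add_zero] at h1
      exact h1
    -- The row `g` annihilates the kernel of the block `R`, so the block system can be solved with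
    -- value `1` at `g`. The resulting kernel pair `(u, w')` gives one complex condition; `(x, y)`
    -- gives another.
    obtain ⟨w', hw'g, hw's, hw'A⟩ := exists_solution_of_kernelOn (mem_bandHerm.1 hA).1 hgR
      (fun z hz => by
        obtain ⟨c, rfl⟩ := hR1 u huK hu0 z hz
        rw [mulVec_smul, Pi.smul_apply, hAug, smul_zero])
    obtain ⟨y, hyg, hys, hyA⟩ := exists_solution_of_kernelOn (mem_bandHerm.1 hA).1 hgL
      (fun z hz => by
        obtain ⟨c, rfl⟩ := hL1 x hxK hx0 z hz
        rw [mulVec_smul, Pi.smul_apply, hAxg, smul_zero])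
    refine le_trans (by omega) (finrank_bandTangent_add_six_le (S := S) (u := u) (w := w') (x := x)
      (y := y) (l := l) (g' := g') (g := g) (j := j) (fun i hi => hRS (huR i hi)) ?_
      (fun i hi => hLS (hxL i hi)) ?_ (by omega) (by omega)
      (isKernelPair_self fun i hi => huK.2 i (huR i hi))
      (isKernelPair_self fun i hi => hxK.2 i (hxL i hi)) ⟨?_, fun i hi => hw'A i (huR i hi)⟩
      ⟨?_, fun i hi => hyA i (hxL i hi)⟩ huj (eq_zero_of_support huR hgR)
      (eq_zero_of_support huR hlR) hxl' (eq_zero_of_support hxL hjL)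
      (eq_zero_of_support hxL hgL) hw'g ?_ hyg ?_)
    · intro i hi
      rcases hw's i hi with rfl | h
      · exact hgS
      · exact hRS h
    · intro i hi
      rcases hys i hi with rfl | h
      · exact hgS'
      · exact hLS h
    · intro i hi
      rcases hw's i hi with rfl | h
      · exact hAug
      · exact huK.2 i h
    · intro i hi
      rcases hys i hi with rfl | h
      · exact hAxg
      · exact hxK.2 i h
    · by_contra h0
      rcases hw's l h0 with h | h
      · have := congrArg Fin.val h; omega
      · exact hlR h
    · by_contra h0
      rcases hys j h0 with h | h
      · have := congrArg Fin.val h; omega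
      · exact hjL h

theorem mem_kernelOn_univ {A : Matrix (Fin n) (Fin n) ℂ} {v : Fin n → ℂ} :
    v ∈ kernelOn A Set.univ ↔ A *ᵥ v = 0 :=
  ⟨fun h => funext fun i => h.2 i trivial, fun h => ⟨fun _ _ => trivial, fun i _ => congrFun h i⟩⟩

/-- A corank two band matrix with a nontransversal kernel. -/
theorem finrank_bandTangent_add_five_le_of_not_surjective (hk : 0 < k)
    {A : Matrix (Fin n) (Fin n) ℂ} (hA : A ∈ bandHerm n k) {v w : Fin n → ℂ}
    (hv : A *ᵥ v = 0) (hw : A *ᵥ w = 0) (hvw : IsOrthonormalPair v w)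
    (hns : ¬ Function.Surjective (compression k v w)) :
    finrank ℝ (bandTangent k A Set.univ) + 5 ≤ finrank ℝ (bandHerm n k) := by
  have hS : {i : Fin n | 0 ≤ (i : ℕ) ∧ (i : ℕ) ≤ n} = Set.univ := by
    ext i; simp only [Set.mem_ofPred_eq, Set.mem_univ, iff_true]; omega
  have := (finrank_bandTangent_of_isOrthonormalPair hk hA (n + 1) 0 n (by omega) v
    (by rw [hS]; exact mem_kernelOn_univ.2 hv) w (by rw [hS]; exact mem_kernelOn_univ.2 hw) hvw).2
    hns
  rwa [hS] at this

/-- A band matrix of corank at least three. -/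
theorem finrank_bandTangent_add_five_le_of_corank (hk : 0 < k)
    {A : Matrix (Fin n) (Fin n) ℂ} (hA : A ∈ bandHerm n k) {e : Fin 3 → Fin n → ℂ}
    (he : ∀ a, A *ᵥ e a = 0) (heo : ∀ a b, star (e a) ⬝ᵥ e b = if a = b then 1 else 0) :
    finrank ℝ (bandTangent k A Set.univ) + 5 ≤ finrank ℝ (bandHerm n k) := by
  -- One row of the 3×3 compression: already five real conditions if onto.
  let Φ : bandHerm n k →ₗ[ℝ] ℝ × ℂ × ℂ :=
    ((Complex.reLm ∘ₗ formAt (e 0) (e 0)).prod ((formAt (e 0) (e 1)).prod (formAt (e 0) (e 2)))) ∘ₗ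
      (bandHerm n k).subtype
  have hΦ : ∀ X, Φ X = ((star (e 0) ⬝ᵥ X.1 *ᵥ e 0).re, star (e 0) ⬝ᵥ X.1 *ᵥ e 1,
    star (e 0) ⬝ᵥ X.1 *ᵥ e 2) := fun _ => rfl
  have hpair : ∀ a b, IsKernelPair A (e a) (e b) := fun a b =>
    ⟨fun i _ => congrFun (he a) i, fun i _ => congrFun (he b) i⟩
  by_cases hs : Function.Surjective Φ
  · have hfr : finrank ℝ (ℝ × ℂ × ℂ) = 5 := by simp
    rw [← hfr]
    refine finrank_add_le_of_le_ker (fun X hX => ?_) hs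
    have h : ∀ a b, star (e a) ⬝ᵥ X.1 *ᵥ e b = 0 := fun a b =>
      hX (e b) (e a) (fun _ _ => trivial) (fun _ _ => trivial) (hpair b a)
    rw [LinearMap.mem_ker, hΦ, h, h, h]
    rfl
  · obtain ⟨f, hf, hf0⟩ := exists_dual_ne_zero_of_not_surjective hs
    obtain ⟨γ₁, hγ₁⟩ := exists_eq_re_mul (f ∘ₗ LinearMap.inr ℝ ℝ (ℂ × ℂ) ∘ₗ LinearMap.inl ℝ ℂ ℂ)
    obtain ⟨γ₂, hγ₂⟩ := exists_eq_re_mul (f ∘ₗ LinearMap.inr ℝ ℝ (ℂ × ℂ) ∘ₗ LinearMap.inr ℝ ℂ ℂ)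
    set α := f (1, 0, 0) with hα
    have hfa : ∀ a b c, f (a, b, c) = a * α + (γ₁ * b + γ₂ * c).re := by
      intro a b c
      have : ((a, b, c) : ℝ × ℂ × ℂ) = a • (1, 0, 0) + (0, b, 0) + (0, 0, c) := by simp
      rw [this, map_add, map_add, map_smul, Complex.add_re, ← hγ₁ b, ← hγ₂ c, ← add_assoc]
      rfl
    have hα0 : α = 0 := by
      have := hf0 ⟨1, one_mem_bandHerm⟩
      rw [hΦ, hfa] at this
      simpa [heo] using this
    -- The obstructing functional is `X ↦ re (e₀* X z)`, its diagonal part being killed by the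
    -- identity matrix. Hence `e 0` and the normalized `z` form a pair with nonsurjective
    -- compression.
    let z : Fin n → ℂ := γ₁ • e 1 + γ₂ • e 2
    let s : ℝ := Complex.normSq γ₁ + Complex.normSq γ₂
    have hs0 : 0 < s := by
      have h1 := Complex.normSq_nonneg γ₁
      have h2 := Complex.normSq_nonneg γ₂
      rcases (add_nonneg h1 h2).lt_or_eq with h | h
      · exact h
      · exfalso
        have e1 : γ₁ = 0 := Complex.normSq_eq_zero.1 (by linarith)
        have e2 : γ₂ = 0 := Complex.normSq_eq_zero.1 (by linarith)
        refine hf (LinearMap.ext fun p => ?_)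
        obtain ⟨a, b, c⟩ := p
        rw [hfa, hα0, e1, e2]; simp
    have hzz : star z ⬝ᵥ z = (s : ℂ) := by
      simp only [z, star_add, star_smul, dotProduct_add, add_dotProduct, smul_dotProduct,
        dotProduct_smul, heo, s]
      simp [Complex.normSq_eq_conj_mul_self, mul_comm]
    have h0z : star (e 0) ⬝ᵥ z = 0 := by
      simp [z, dotProduct_add, dotProduct_smul, heo]
    have hsq : ((Real.sqrt s : ℝ) : ℂ) ≠ 0 := by
      rw [Complex.ofReal_ne_zero]; exact (Real.sqrt_pos.2 hs0).ne'
    have hsq2 : ((Real.sqrt s : ℝ) : ℂ) * (Real.sqrt s : ℝ) = s := by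
      rw [← Complex.ofReal_mul, Real.mul_self_sqrt hs0.le]
    let y : Fin n → ℂ := ((Real.sqrt s : ℝ) : ℂ)⁻¹ • z
    have hzy : z = ((Real.sqrt s : ℝ) : ℂ) • y := by
      rw [smul_smul, mul_inv_cancel₀ hsq, one_smul]
    refine finrank_bandTangent_add_five_le_of_not_surjective hk hA (v := e 0) (w := y) (he 0) ?_
      ⟨by simp [heo], ?_, ?_⟩ ?_
    · simp [y, z, mulVec_smul, mulVec_add, he]
    · simp only [y, star_smul, smul_dotProduct, dotProduct_smul, hzz, smul_eq_mul, ← hsq2]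
      simp only [Complex.star_def, map_inv₀, Complex.conj_ofReal]
      field_simp
    · rw [dotProduct_smul, h0z, smul_zero]
    · intro hsurj
      obtain ⟨X, hX⟩ := hsurj (0, 0, 1)
      have h1 := hf0 X
      rw [hΦ, hfa, hα0, mul_zero, zero_add] at h1
      have h2 : γ₁ * (star (e 0) ⬝ᵥ X.1 *ᵥ e 1) + γ₂ * (star (e 0) ⬝ᵥ X.1 *ᵥ e 2)
          = ((Real.sqrt s : ℝ) : ℂ) * (star (e 0) ⬝ᵥ X.1 *ᵥ y) := by
        rw [← smul_eq_mul ((Real.sqrt s : ℝ) : ℂ), ← dotProduct_smul, ← mulVec_smul, ← hzy]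
        simp [z, mulVec_add, mulVec_smul, dotProduct_add, dotProduct_smul]
      have h3 : star (e 0) ⬝ᵥ X.1 *ᵥ y = 1 := by
        rw [compression_apply] at hX
        exact congrArg (fun p => p.2.2) hX
      rw [h2, h3, mul_one, Complex.ofReal_re] at h1
      exact (Real.sqrt_pos.2 hs0).ne' h1

end Codimension

/-! ### Hausdorff dimension of the exceptional sets. -/

section BadSets

open Matrix

variable {n k : ℕ}

theorem star_dotProduct_eq_zero_of_mem_stratumTangent {A X : Matrix (Fin n) (Fin n) ℂ}
    (hX : X ∈ stratumTangent A Set.univ) {v w : Fin n → ℂ} (hv : A *ᵥ v = 0) (hw : A *ᵥ w = 0) :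
    star w ⬝ᵥ X *ᵥ v = 0 :=
  hX v w (fun _ _ => trivial) (fun _ _ => trivial)
    ⟨fun i _ => congrFun hv i, fun i _ => congrFun hw i⟩

theorem sub_smul_one_mulVec_eq_zero {A : Matrix (Fin n) (Fin n) ℂ} {s : ℝ} {v : Fin n → ℂ}
    (h : A *ᵥ v = (s : ℂ) • v) : (A - s • (1 : Matrix (Fin n) (Fin n) ℂ)) *ᵥ v = 0 := by
  rw [sub_mulVec, smul_mulVec, one_mulVec, h]
  ext i; simp

theorem finrank_comap_fst_sub_le {V : Type*} [AddCommGroup V] [Module ℝ V] [FiniteDimensional ℝ V]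
    (T : Submodule ℝ V) (e : V) :
    finrank ℝ (T.comap (LinearMap.fst ℝ V ℝ - LinearMap.toSpanSingleton ℝ V e ∘ₗ
      LinearMap.snd ℝ V ℝ)) ≤ finrank ℝ T + 1 := by
  set Λ := LinearMap.fst ℝ V ℝ - LinearMap.toSpanSingleton ℝ V e ∘ₗ LinearMap.snd ℝ V ℝ with hΛ
  let ψ : T.comap Λ →ₗ[ℝ] T × ℝ :=
    ((Λ ∘ₗ (T.comap Λ).subtype).codRestrict T fun x => x.2).prod
      (LinearMap.snd ℝ _ _ ∘ₗ (T.comap Λ).subtype)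
  have hψ : Function.Injective ψ := by
    rw [← LinearMap.ker_eq_bot, LinearMap.ker_eq_bot']
    intro x hx
    have h2 : x.1.2 = 0 := congrArg Prod.snd hx
    have h3 : x.1.1 - x.1.2 • e = 0 := congrArg (fun q : T × ℝ => (q.1 : V)) hx
    rw [h2, zero_smul, sub_zero] at h3
    exact Subtype.ext (Prod.ext h3 h2)
  simpa using LinearMap.finrank_le_finrank_of_injective hψ

/-- The set is the Lipschitz image of a set of pairs `(A, s)`. Five conditions on `A - s` leave a
tangent space of dimension at most `(N - 5) + 1` in the space of pairs, where `N` is the dimension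
of `bandHerm n k`. -/
theorem dimH_degenerate_le :
    dimH {A : bandHerm n k | ∃ s : ℝ, finrank ℝ (bandTangent k (A.1 - s • 1) Set.univ) + 5
      ≤ finrank ℝ (bandHerm n k)} ≤ (finrank ℝ (bandHerm n k) - 4 : ℕ) := by
  set S : Set (bandHerm n k × ℝ) := {p | finrank ℝ (bandTangent k (p.1.1 - p.2 • 1) Set.univ) + 5
      ≤ finrank ℝ (bandHerm n k)} with hS
  have himage : {A : bandHerm n k | ∃ s : ℝ, finrank ℝ (bandTangent k (A.1 - s • 1) Set.univ) + 5
      ≤ finrank ℝ (bandHerm n k)} = Prod.fst '' S := by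
    ext A; simp [hS]
  rw [himage]
  refine (LipschitzWith.prod_fst.dimH_image_le S).trans ?_
  let one' : bandHerm n k := ⟨1, one_mem_bandHerm⟩
  let Λ' : bandHerm n k × ℝ →ₗ[ℝ] bandHerm n k :=
    LinearMap.fst ℝ _ _ - (LinearMap.toSpanSingleton ℝ _ one') ∘ₗ LinearMap.snd ℝ _ _
  let Λ : bandHerm n k × ℝ →ₗ[ℝ] Matrix (Fin n) (Fin n) ℂ := (bandHerm n k).subtype ∘ₗ Λ'
  have hΛ : ∀ p, Λ p = p.1.1 - p.2 • (1 : Matrix (Fin n) (Fin n) ℂ) := fun p => rfl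
  refine dimH_le_of_finrank_stratumTangent (κ := Unit) S (fun _ => Λ) _
    (fun _ p _ => (mem_bandHerm.1 (Λ' p).2).1) fun p hp => ?_
  rw [iInf_const, hΛ p]
  have hp' : finrank ℝ (bandTangent k (p.1.1 - p.2 • 1) Set.univ) + 5
      ≤ finrank ℝ (bandHerm n k) := hp
  have h1 := finrank_comap_fst_sub_le
    (bandTangent k (p.1.1 - p.2 • (1 : Matrix (Fin n) (Fin n) ℂ)) Set.univ) one'
  exact h1.trans (by omega)

/-- The derivative of the `i`-th diagonal entry of `A * Y` in the Hermitian matrix `Y`, shifted. -/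
noncomputable def diagProbe (A : Matrix (Fin n) (Fin n) ℂ) (s : ℝ) (i : Fin n) : Matrix (Fin n) (Fin n) ℂ :=
  Matrix.single i i 1 * (A - s • 1) + (A - s • 1) * Matrix.single i i 1

theorem diagProbe_mem {A : Matrix (Fin n) (Fin n) ℂ} (hA : A ∈ bandHerm n k) (s : ℝ) (i : Fin n) :
    diagProbe A s i ∈ bandHerm n k := by
  have hB := mem_bandHerm.1 (sub_smul_one_mem_bandHerm hA s)
  rw [diagProbe]
  set B := A - s • (1 : Matrix (Fin n) (Fin n) ℂ)
  refine mem_bandHerm.2 ⟨?_, fun a b hab => hB.2 a b fun h0 => hab ?_⟩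
  · rw [IsHermitian, conjTranspose_add, conjTranspose_mul, conjTranspose_mul, hB.1.eq,
      conjTranspose_single, star_one, add_comm]
  · have h1 : (Matrix.single i i (1 : ℂ) * B) a b = 0 := by
      by_cases h : a = i
      · subst h; simp [h0]
      · simp [h]
    have h2 : (B * Matrix.single i i (1 : ℂ)) a b = 0 := by
      by_cases h : b = i
      · subst h; simp [h0]
      · simp [h]
    rw [Matrix.add_apply, h1, h2, add_zero]

/-- The anticommutator of `A - s` with the diagonal unit at `i` vanishes as a form on the eigenspace
of `s`, yet on that of `t ≠ s` it is a nonzero multiple of the diagonal unit. It thus perturbs one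
eigenspace without affecting the other, and it stays in the band. -/
theorem star_dotProduct_diagProbe {A : Matrix (Fin n) (Fin n) ℂ} (hA : A.IsHermitian) (s t : ℝ)
    (i : Fin n) {v w : Fin n → ℂ} (hv : A *ᵥ v = (t : ℂ) • v) (hw : A *ᵥ w = (t : ℂ) • w) :
    star w ⬝ᵥ diagProbe A s i *ᵥ v = 2 * (t - s) * (star (w i) * v i) := by
  have hB : ∀ x : Fin n → ℂ, A *ᵥ x = (t : ℂ) • x →
      (A - s • (1 : Matrix (Fin n) (Fin n) ℂ)) *ᵥ x = ((t - s : ℝ) : ℂ) • x := by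
    intro x hx
    rw [sub_mulVec, smul_mulVec, one_mulVec, hx]
    ext j; simp [sub_mul]
  have hBh : (A - s • (1 : Matrix (Fin n) (Fin n) ℂ)).IsHermitian := by
    have h1 : (s • (1 : Matrix (Fin n) (Fin n) ℂ)).IsHermitian := by
      rw [IsHermitian, conjTranspose_smul, conjTranspose_one, star_trivial]
    exact hA.sub h1
  have hsingle : ∀ x y : Fin n → ℂ, star y ⬝ᵥ Matrix.single i i (1 : ℂ) *ᵥ x
      = star (y i) * x i := by
    intro x y
    rw [single_mulVec, ← Pi.single]
    simp
  rw [diagProbe, add_mulVec, dotProduct_add, ← mulVec_mulVec, ← mulVec_mulVec, hB v hv,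
    mulVec_smul, dotProduct_smul, hsingle]
  rw [dotProduct_mulVec _ (A - s • (1 : Matrix (Fin n) (Fin n) ℂ)), ← hBh.eq, ← star_mulVec,
    hB w hw, star_smul, smul_dotProduct, hsingle]
  simp only [smul_eq_mul, Complex.star_def, Complex.conj_ofReal]
  push_cast; ring

/-- Some diagonal unit has a nonscalar compression to `span {v, w}`: otherwise, at every index, `v
i` and `w i` have equal modulus and product of moduli zero, so `v = 0`. -/
theorem exists_index_of_isOrthonormalPair {v w : Fin n → ℂ} (h : IsOrthonormalPair v w) :
    ∃ i, ¬ (star (v i) * w i = 0 ∧ star (v i) * v i = star (w i) * w i) := by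
  by_contra hcon
  push Not at hcon
  have hv : v = 0 := by
    ext i
    obtain ⟨h1, h2⟩ := hcon i
    by_contra h0
    have h3 : w i = 0 := (mul_eq_zero.1 h1).resolve_left (star_ne_zero.2 h0)
    rw [h3, mul_zero] at h2
    exact (mul_ne_zero (star_ne_zero.2 h0) h0) h2
  rw [hv] at h
  simpa using h.1

/-- Over the triples `(A, s, t)`, of dimension `N + 2` with `N` the dimension of `bandHerm n k`,
surjectivity at `t` gives four conditions and the eigenvalue `s` two more. That leaves `N - 4`, and
projecting to `A` does not increase the dimension. -/
theorem dimH_two_double_eigenvalues_le :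
    dimH {A : bandHerm n k | ∃ s t : ℝ, s ≠ t ∧
      (∃ v w, IsOrthonormalPair v w ∧ A.1 *ᵥ v = (s : ℂ) • v ∧ A.1 *ᵥ w = (s : ℂ) • w) ∧
      ∃ v w, IsOrthonormalPair v w ∧ A.1 *ᵥ v = (t : ℂ) • v ∧ A.1 *ᵥ w = (t : ℂ) • w ∧
        Function.Surjective (compression k v w)} ≤ (finrank ℝ (bandHerm n k) - 4 : ℕ) := by
  set S : Set (bandHerm n k × ℝ × ℝ) := {p | p.2.1 ≠ p.2.2 ∧
      (∃ v w, IsOrthonormalPair v w ∧ p.1.1 *ᵥ v = (p.2.1 : ℂ) • v ∧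
        p.1.1 *ᵥ w = (p.2.1 : ℂ) • w) ∧
      ∃ v w, IsOrthonormalPair v w ∧ p.1.1 *ᵥ v = (p.2.2 : ℂ) • v ∧
        p.1.1 *ᵥ w = (p.2.2 : ℂ) • w ∧ Function.Surjective (compression k v w)} with hS
  refine (dimH_mono (t := Prod.fst '' S) ?_).trans
    ((LipschitzWith.prod_fst.dimH_image_le S).trans ?_)
  · rintro A ⟨s, t, h⟩
    exact ⟨(A, s, t), h, rfl⟩
  let one' : bandHerm n k := ⟨1, one_mem_bandHerm⟩
  let Λ' : Bool → bandHerm n k × ℝ × ℝ →ₗ[ℝ] bandHerm n k := fun a =>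
    LinearMap.fst ℝ _ _ - (LinearMap.toSpanSingleton ℝ _ one') ∘ₗ
      (bif a then LinearMap.fst ℝ ℝ ℝ else LinearMap.snd ℝ ℝ ℝ) ∘ₗ LinearMap.snd ℝ _ _
  let Λ : Bool → bandHerm n k × ℝ × ℝ →ₗ[ℝ] Matrix (Fin n) (Fin n) ℂ := fun a =>
    (bandHerm n k).subtype ∘ₗ Λ' a
  have hΛt : ∀ p, Λ true p = p.1.1 - p.2.1 • (1 : Matrix (Fin n) (Fin n) ℂ) := fun p => rfl
  have hΛf : ∀ p, Λ false p = p.1.1 - p.2.2 • (1 : Matrix (Fin n) (Fin n) ℂ) := fun p => rfl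
  refine dimH_le_of_finrank_stratumTangent (κ := Bool) S Λ _
    (fun a p _ => (mem_bandHerm.1 (Λ' a p).2).1) fun p hp => ?_
  obtain ⟨⟨A, hA⟩, s, t⟩ := p
  obtain ⟨hst, ⟨v, w, hvw, hv, hw⟩, v', w', hvw', hv', hw', hsurj⟩ := hp
  simp only at hst hv hw hv' hw'
  have hAh := (mem_bandHerm.1 hA).1
  obtain ⟨r, hr⟩ := (compression k v' w').exists_rightInverse_of_surjective
    (LinearMap.range_eq_top.2 hsurj)
  obtain ⟨i, hi⟩ := exists_index_of_isOrthonormalPair hvw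
  let Y : bandHerm n k := ⟨diagProbe A t i, diagProbe_mem hA t i⟩
  have hYc : compression k v' w' Y = 0 := by
    rw [compression_apply]
    change ((star v' ⬝ᵥ diagProbe A t i *ᵥ v').re, (star w' ⬝ᵥ diagProbe A t i *ᵥ w').re,
      star v' ⬝ᵥ diagProbe A t i *ᵥ w') = 0
    rw [star_dotProduct_diagProbe hAh t t i hv' hv', star_dotProduct_diagProbe hAh t t i hw' hw',
      star_dotProduct_diagProbe hAh t t i hw' hv']
    simp
  -- Six directions: four realise every compression at `t`, one is the probe `Y` invisible at `t`,
  -- and one moves `s`. At `s` the last two give a nonscalar and a scalar form, hence are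
  -- independent.
  let Ψ : (ℝ × ℝ × ℂ) × ℝ × ℝ →ₗ[ℝ] bandHerm n k × ℝ × ℝ :=
    (r.coprod ((LinearMap.toSpanSingleton ℝ _ Y) ∘ₗ LinearMap.fst ℝ ℝ ℝ)).prod
      (LinearMap.inl ℝ ℝ ℝ ∘ₗ LinearMap.snd ℝ ℝ ℝ ∘ₗ LinearMap.snd ℝ _ _)
  have hΨ : ∀ q τ c, Ψ (q, τ, c) = (r q + τ • Y, c, 0) := fun _ _ _ => rfl
  have hmain := finrank_add_le_of_comap_eq_bot
    (⨅ a, (stratumTangent (Λ a (⟨A, hA⟩, s, t)) Set.univ).comap (Λ a)) Ψ ?_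
  · have h1 : finrank ℝ ((ℝ × ℝ × ℂ) × ℝ × ℝ) = 6 := by simp
    have h2 : finrank ℝ (bandHerm n k × ℝ × ℝ) = finrank ℝ (bandHerm n k) + 2 := by simp
    rw [h1, h2] at hmain
    omega
  rintro ⟨q, τ, c⟩ hmem
  rw [hΨ, Submodule.mem_iInf] at hmem
  have hf := hmem false
  have ht := hmem true
  rw [Submodule.mem_comap, hΛf, hΛf] at hf
  rw [Submodule.mem_comap, hΛt, hΛt] at ht
  simp only [zero_smul, sub_zero] at hf
  have ev' := sub_smul_one_mulVec_eq_zero hv'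
  have ew' := sub_smul_one_mulVec_eq_zero hw'
  have ev := sub_smul_one_mulVec_eq_zero hv
  have ew := sub_smul_one_mulVec_eq_zero hw
  have hq : q = 0 := by
    have h1 : compression k v' w' (r q + τ • Y) = 0 := by
      rw [compression_apply, star_dotProduct_eq_zero_of_mem_stratumTangent hf ev' ev',
        star_dotProduct_eq_zero_of_mem_stratumTangent hf ew' ew',
        star_dotProduct_eq_zero_of_mem_stratumTangent hf ew' ev']
      rfl
    rw [map_add, map_smul, hYc, smul_zero, add_zero] at h1
    rw [← h1]
    exact (LinearMap.congr_fun hr q).symm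
  subst hq
  have hX : ∀ x y : Fin n → ℂ, A *ᵥ x = (s : ℂ) • x → A *ᵥ y = (s : ℂ) • y →
      τ * (2 * (s - t) * (star (y i) * x i)) - c * (star y ⬝ᵥ x) = 0 := by
    intro x y hx hy
    have h1 := star_dotProduct_eq_zero_of_mem_stratumTangent ht (sub_smul_one_mulVec_eq_zero hx)
      (sub_smul_one_mulVec_eq_zero hy)
    have h2 : ((r 0 + τ • Y : bandHerm n k) : Matrix (Fin n) (Fin n) ℂ)
        = τ • diagProbe A t i := by
      rw [map_zero, zero_add]; rfl
    rw [h2, sub_mulVec, smul_mulVec, smul_mulVec, one_mulVec, dotProduct_sub, dotProduct_smul,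
      dotProduct_smul, star_dotProduct_diagProbe hAh t s i hx hy] at h1
    simpa using h1
  have h1 := hX v v hv hv
  have h2 := hX w w hw hw
  have h3 := hX w v hw hv
  rw [hvw.1, mul_one] at h1
  rw [hvw.2.1, mul_one] at h2
  rw [hvw.2.2, mul_zero, sub_zero] at h3
  have hst' : (s - t : ℂ) ≠ 0 := by
    rw [← Complex.ofReal_sub, Complex.ofReal_ne_zero]; exact sub_ne_zero.2 hst
  have hτ : τ = 0 := by
    by_contra hτ
    have hτ' : (τ : ℂ) ≠ 0 := Complex.ofReal_ne_zero.2 hτ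
    have hne : (τ * (2 * (s - t)) : ℂ) ≠ 0 :=
      mul_ne_zero hτ' (mul_ne_zero two_ne_zero hst')
    refine hi ⟨?_, ?_⟩
    · refine (mul_eq_zero.1 (?_ : (τ * (2 * (s - t)) : ℂ) * (star (v i) * w i) = 0)).resolve_left hne
      rw [← h3]; ring
    · refine mul_left_cancel₀ hne ?_
      linear_combination h1 - h2
  subst hτ
  have hc : c = 0 := by simpa using h1
  subst hc
  rfl

end BadSets

/-! ### The dimension of the space of Hermitian band matrices. -/

section Finrank

open Matrix

variable {n k : ℕ}

/-- The index pairs within the band. -/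
abbrev BandIndex (n k : ℕ) : Type :=
  {p : Fin n × Fin n // ((p.2 : ℤ) - (p.1 : ℤ)).natAbs ≤ k}

/-- A Hermitian band matrix is determined by the real parts of the entries on and above the
diagonal and the imaginary parts of the entries below the diagonal. -/
noncomputable def bandCoordinates (n k : ℕ) : bandHerm n k ≃ₗ[ℝ] (BandIndex n k → ℝ) where
  toFun X p := if p.1.1 ≤ p.1.2 then (X.1 p.1.1 p.1.2).re else (X.1 p.1.1 p.1.2).im
  map_add' X Y := by
    ext p; by_cases h : p.1.1 ≤ p.1.2 <;> simp [h]
  map_smul' c X := by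
    ext p; by_cases h : p.1.1 ≤ p.1.2 <;> simp [h]
  invFun c := ⟨Matrix.of fun i j => if h : ((j : ℤ) - (i : ℤ)).natAbs ≤ k then
      if i < j then ⟨c ⟨(i, j), h⟩, -c ⟨(j, i), by rw [← Int.natAbs_neg, neg_sub]; exact h⟩⟩
      else if i = j then ⟨c ⟨(i, j), h⟩, 0⟩
      else ⟨c ⟨(j, i), by rw [← Int.natAbs_neg, neg_sub]; exact h⟩, c ⟨(i, j), h⟩⟩
    else 0, by
    refine mem_bandHerm.2 ⟨?_, fun i j hij => ?_⟩
    · ext i j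
      rw [conjTranspose_apply, of_apply, of_apply]
      have hsymm : ((i : ℤ) - (j : ℤ)).natAbs ≤ k ↔ ((j : ℤ) - (i : ℤ)).natAbs ≤ k := by
        rw [← Int.natAbs_neg, neg_sub]
      by_cases h : ((j : ℤ) - (i : ℤ)).natAbs ≤ k
      · rw [dif_pos h, dif_pos (hsymm.2 h)]
        rcases lt_trichotomy i j with hlt | rfl | hgt
        · rw [if_neg hlt.asymm, if_neg hlt.ne', if_pos hlt]
          apply Complex.ext <;> simp
        · simp only [lt_irrefl, if_false, if_true]
          apply Complex.ext <;> simp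
        · rw [if_pos hgt, if_neg hgt.asymm, if_neg hgt.ne']
          apply Complex.ext <;> simp
      · rw [dif_neg h, dif_neg (mt hsymm.1 h), star_zero]
    · by_contra h
      exact hij (by rw [of_apply, dif_neg h])⟩
  left_inv X := by
    have hX := mem_bandHerm.1 X.2
    ext i j
    simp only [of_apply]
    by_cases h : ((j : ℤ) - (i : ℤ)).natAbs ≤ k
    · rw [dif_pos h]
      have hij := hX.1.apply i j
      rcases lt_trichotomy i j with hlt | rfl | hgt
      · rw [if_pos hlt, if_pos hlt.le, if_neg hlt.not_ge, ← hij]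
        apply Complex.ext <;> simp
      · simp only [lt_irrefl, if_false, if_true, le_refl]
        apply Complex.ext
        · simp
        · have := congrArg Complex.im hij
          simp only [Complex.star_def, Complex.conj_im] at this
          simp only
          linarith
      · rw [if_neg hgt.asymm, if_neg hgt.ne', if_pos hgt.le, if_neg hgt.not_ge, ← hij]
        apply Complex.ext <;> simp
    · rw [dif_neg h, apply_eq_zero_of_mem_bandHerm X.2 (not_le.1 h)]
  right_inv c := by
    ext ⟨⟨i, j⟩, h⟩
    simp only [of_apply]
    rw [dif_pos h]
    rcases lt_trichotomy i j with hlt | rfl | hgt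
    · simp [hlt, hlt.le]
    · simp
    · simp [hgt.not_ge, hgt.asymm, hgt.ne']

theorem sum_min_range (n k : ℕ) (h : k < n) :
    2 * ((∑ i ∈ Finset.range n, min i k : ℕ) : ℤ) = k * (2 * n - k - 1) := by
  induction n with
  | zero => omega
  | succ m ih =>
    rcases Nat.lt_or_ge k m with h1 | h1
    · rw [Finset.sum_range_succ, min_eq_right h1.le]
      push_cast at ih ⊢
      rw [mul_add, ih h1]; ring
    · have hkm : k = m := by omega
      subst hkm
      have h2 : ∑ i ∈ Finset.range (k + 1), min i k = ∑ i ∈ Finset.range (k + 1), i :=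
        Finset.sum_congr rfl fun i hi => min_eq_left (by simp at hi; omega)
      have h3 : (∑ i ∈ Finset.range (k + 1), i) * 2 = (k + 1) * k :=
        Finset.sum_range_id_mul_two (k + 1)
      rw [h2]
      zify at h3
      push_cast at h3 ⊢
      linarith

theorem card_bandIndex (n k : ℕ) :
    Fintype.card (BandIndex n k) = n + 2 * ∑ i ∈ Finset.range n, min i k := by
  have hrow : ∀ i : ℕ, ((Finset.range (i + 1)).filter fun j => i ≤ j + k).card = min i k + 1 := by
    intro i
    have : ((Finset.range (i + 1)).filter fun j => i ≤ j + k) = Finset.Icc (i - k) i := by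
      ext j; simp only [Finset.mem_filter, Finset.mem_range, Finset.mem_Icc]; omega
    rw [this, Nat.card_Icc]; omega
  have hrow' : ∀ i : ℕ, ((Finset.range i).filter fun j => i ≤ j + k).card = min i k := by
    intro i
    have : ((Finset.range i).filter fun j => i ≤ j + k) = Finset.Ico (i - k) i := by
      ext j; simp only [Finset.mem_filter, Finset.mem_range, Finset.mem_Ico]; omega
    rw [this, Nat.card_Ico]; omega
  have hcard : ∀ m : ℕ, (((Finset.range m) ×ˢ (Finset.range m)).filter
      fun p => ((p.2 : ℤ) - (p.1 : ℤ)).natAbs ≤ k).card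
        = m + 2 * ∑ i ∈ Finset.range m, min i k := by
    intro m
    induction m with
    | zero => simp
    | succ m ih =>
      -- Enlarging the matrix by one adds the last row with its corner, `min m k + 1` band entries,
      -- and the last column without it, `min m k` entries.
      have hsplit : (((Finset.range (m + 1)) ×ˢ (Finset.range (m + 1))).filter
          fun p : ℕ × ℕ => ((p.2 : ℤ) - (p.1 : ℤ)).natAbs ≤ k)
          = (((Finset.range m) ×ˢ (Finset.range m)).filter
              fun p => ((p.2 : ℤ) - (p.1 : ℤ)).natAbs ≤ k)
            ∪ ((((Finset.range (m + 1)).filter fun j => m ≤ j + k).image fun j => (m, j))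
            ∪ (((Finset.range m).filter fun j => m ≤ j + k).image fun j => (j, m))) := by
        ext ⟨a, b⟩
        simp only [Finset.mem_filter, Finset.mem_product, Finset.mem_range, Finset.mem_union,
          Finset.mem_image, Prod.mk.injEq]
        constructor
        · rintro ⟨⟨h1, h2⟩, h3⟩
          by_cases ha : a = m
          · exact Or.inr (Or.inl ⟨b, ⟨h2, by omega⟩, ha.symm, rfl⟩)
          · by_cases hb : b = m
            · exact Or.inr (Or.inr ⟨a, ⟨by omega, by omega⟩, rfl, hb.symm⟩)
            · exact Or.inl ⟨⟨by omega, by omega⟩, h3⟩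
        · rintro (⟨⟨h1, h2⟩, h3⟩ | ⟨j, ⟨h1, h2⟩, rfl, rfl⟩ | ⟨j, ⟨h1, h2⟩, rfl, rfl⟩)
          · exact ⟨⟨by omega, by omega⟩, h3⟩
          · exact ⟨⟨by omega, by omega⟩, by omega⟩
          · exact ⟨⟨by omega, by omega⟩, by omega⟩
      rw [hsplit, Finset.card_union_of_disjoint, Finset.card_union_of_disjoint,
        Finset.card_image_of_injective _ (Prod.mk_right_injective m),
        Finset.card_image_of_injective _ (Prod.mk_left_injective m), hrow, hrow', ih,
        Finset.sum_range_succ]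
      · ring
      · rw [Finset.disjoint_left]
        rintro ⟨a, b⟩ h1 h2
        simp only [Finset.mem_image, Finset.mem_filter, Finset.mem_range, Prod.mk.injEq] at h1 h2
        obtain ⟨j, hj, rfl, rfl⟩ := h1
        obtain ⟨j', hj', h3, h4⟩ := h2
        omega
      · rw [Finset.disjoint_left]
        rintro ⟨a, b⟩ h1 h2
        simp only [Finset.mem_filter, Finset.mem_product, Finset.mem_range, Finset.mem_union,
          Finset.mem_image, Prod.mk.injEq] at h1 h2
        rcases h2 with ⟨j, hj, rfl, rfl⟩ | ⟨j, hj, rfl, rfl⟩ <;> omega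
  rw [← hcard n, Fintype.card_subtype]
  refine Finset.card_bij (fun p _ => ((p.1 : ℕ), (p.2 : ℕ))) ?_ ?_ ?_
  · rintro ⟨i, j⟩ h
    simpa using h
  · rintro ⟨i, j⟩ _ ⟨i', j'⟩ _ h
    simp only [Prod.mk.injEq] at h
    exact Prod.ext (Fin.ext h.1) (Fin.ext h.2)
  · rintro ⟨a, b⟩ h
    simp only [Finset.mem_filter, Finset.mem_product, Finset.mem_range] at h
    exact ⟨(⟨a, h.1.1⟩, ⟨b, h.1.2⟩), by simpa using h.2, rfl⟩

theorem finrank_bandHerm (hkn : k < n) :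
    (finrank ℝ (bandHerm n k) : ℤ) = (n : ℤ) * (2 * k + 1) - k * (k + 1) := by
  rw [(bandCoordinates n k).finrank_eq, Module.finrank_pi, card_bandIndex]
  push_cast
  have := sum_min_range n k hkn
  push_cast at this
  rw [this]; ring

theorem four_le_finrank_bandHerm (hk : 0 < k) (hkn : k < n) : 4 ≤ finrank ℝ (bandHerm n k) := by
  have h := finrank_bandHerm hkn
  have h1 : (1 : ℤ) ≤ k := by exact_mod_cast hk
  have h2 : (k : ℤ) + 1 ≤ n := by exact_mod_cast hkn
  have h3 : (4 : ℤ) ≤ finrank ℝ (bandHerm n k) := by rw [h]; nlinarith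
  exact_mod_cast h3

end Finrank

/-! ### Orthonormal eigenvector pairs and continuity of multiple eigenvalues. -/

section Eigenvectors

open Matrix

variable {n k : ℕ}

theorem isDerogatory_of_pair {A : Matrix (Fin n) (Fin n) ℂ} {s : ℂ} {x y : Fin n → ℂ}
    (hx : A *ᵥ x = s • x) (hy : A *ᵥ y = s • y) (h : LinearIndependent ℂ ![x, y]) :
    IsDerogatory A := by
  refine ⟨s, ?_⟩
  have hx' : x ∈ Module.End.eigenspace (Matrix.toLin' A) s := Module.End.mem_eigenspace_iff.2 hx
  have hy' : y ∈ Module.End.eigenspace (Matrix.toLin' A) s := Module.End.mem_eigenspace_iff.2 hy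
  have h1 : LinearIndependent ℂ
      ![(⟨x, hx'⟩ : Module.End.eigenspace (Matrix.toLin' A) s), ⟨y, hy'⟩] := by
    refine LinearIndependent.of_comp (Module.End.eigenspace (Matrix.toLin' A) s).subtype ?_
    have hcomp : (Module.End.eigenspace (Matrix.toLin' A) s).subtype ∘
        ![(⟨x, hx'⟩ : Module.End.eigenspace (Matrix.toLin' A) s), ⟨y, hy'⟩] = ![x, y] := by
      ext i; fin_cases i <;> rfl
    rw [hcomp]
    exact h
  have h2 := h1.fintype_card_le_finrank
  rw [Fintype.card_fin] at h2
  omega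

theorem linearIndependent_pair_of_dual {v w x y : Fin n → ℂ} (h1 : star v ⬝ᵥ x = 1)
    (h2 : star w ⬝ᵥ x = 0) (h3 : star v ⬝ᵥ y = 0) (h4 : star w ⬝ᵥ y = 1) :
    LinearIndependent ℂ ![x, y] := by
  rw [LinearIndependent.pair_iff]
  intro a b hab
  have e1 := congrArg (fun z => star v ⬝ᵥ z) hab
  have e2 := congrArg (fun z => star w ⬝ᵥ z) hab
  simp only [dotProduct_add, dotProduct_smul, h1, h2, h3, h4, dotProduct_zero] at e1 e2
  exact ⟨by simpa using e1, by simpa using e2⟩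

theorem IsOrthonormalPair.symm {v w : Fin n → ℂ} (h : IsOrthonormalPair v w) :
    star w ⬝ᵥ v = 0 := by
  have := congrArg star h.2.2
  rwa [← star_dotProduct_star, star_star, star_zero] at this

theorem eigenvalue_real {A : Matrix (Fin n) (Fin n) ℂ} (hA : A.IsHermitian) {s : ℂ}
    {v : Fin n → ℂ} (hv : star v ⬝ᵥ v = 1) (h : A *ᵥ v = s • v) : (s.re : ℂ) = s := by
  have h1 := star_dotProduct_mulVec_comm hA v v
  rw [h, dotProduct_smul, hv, smul_eq_mul, mul_one] at h1
  exact Complex.conj_eq_iff_re.1 h1.symm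

theorem exists_pair_of_isDerogatory {A : Matrix (Fin n) (Fin n) ℂ} (hA : A.IsHermitian)
    (h : IsDerogatory A) : ∃ (s : ℝ) (v w : Fin n → ℂ), IsOrthonormalPair v w ∧
      A *ᵥ v = (s : ℂ) • v ∧ A *ᵥ w = (s : ℂ) • w := by
  obtain ⟨s, hs⟩ := h
  obtain ⟨e, he, heo⟩ := exists_orthonormal_of_le_finrank (Nat.succ_le_of_lt hs)
  have h0 : A *ᵥ e 0 = s • e 0 := Module.End.mem_eigenspace_iff.1 (he 0)
  have h1 : A *ᵥ e 1 = s • e 1 := Module.End.mem_eigenspace_iff.1 (he 1)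
  have hs' := eigenvalue_real hA (by simp [heo]) h0
  exact ⟨s.re, e 0, e 1, ⟨by simp [heo], by simp [heo], by simp [heo]⟩, by rw [hs', h0],
    by rw [hs', h1]⟩

theorem isCompact_orthonormalPairs :
    IsCompact {p : (Fin n → ℂ) × (Fin n → ℂ) | IsOrthonormalPair p.1 p.2} := by
  refine Metric.isCompact_of_isClosed_isBounded ?_ ?_
  · have h1 : Continuous fun p : (Fin n → ℂ) × (Fin n → ℂ) => star p.1 ⬝ᵥ p.1 := by fun_prop
    have h2 : Continuous fun p : (Fin n → ℂ) × (Fin n → ℂ) => star p.2 ⬝ᵥ p.2 := by fun_prop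
    have h3 : Continuous fun p : (Fin n → ℂ) × (Fin n → ℂ) => star p.1 ⬝ᵥ p.2 := by fun_prop
    exact (isClosed_eq h1 continuous_const).inter ((isClosed_eq h2 continuous_const).inter
      (isClosed_eq h3 continuous_const))
  · have hb : ∀ v : Fin n → ℂ, star v ⬝ᵥ v = 1 → ‖v‖ ≤ 1 := by
      intro v hv
      rw [pi_norm_le_iff_of_nonneg zero_le_one]
      intro i
      have h1 : ∑ j, Complex.normSq (v j) = 1 := by
        have : ((∑ j, Complex.normSq (v j) : ℝ) : ℂ) = 1 := by
          rw [← hv, dotProduct, Complex.ofReal_sum]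
          exact Finset.sum_congr rfl fun j _ => Complex.normSq_eq_conj_mul_self
        exact_mod_cast this
      have h2 : Complex.normSq (v i) ≤ 1 := by
        rw [← h1]
        exact Finset.single_le_sum (f := fun j => Complex.normSq (v j))
          (fun j _ => Complex.normSq_nonneg _) (Finset.mem_univ i)
      rw [Complex.normSq_eq_norm_sq] at h2
      nlinarith [norm_nonneg (v i)]
    refine (Metric.isBounded_closedBall (x := (0 : (Fin n → ℂ) × (Fin n → ℂ)))
      (r := 1)).subset fun p hp => ?_
    rw [mem_closedBall_zero_iff, Prod.norm_def]
    exact max_le (hb _ hp.1) (hb _ hp.2.1)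

/-- Multiple eigenvalues of the Hermitian matrices near `A₀` are near those of `A₀`. -/
theorem eventually_eigenvalue_mem {A₀ : bandHerm n k} {s₀ : ℝ}
    (huniq : ∀ (s : ℝ) (v w : Fin n → ℂ), IsOrthonormalPair v w → A₀.1 *ᵥ v = (s : ℂ) • v →
      A₀.1 *ᵥ w = (s : ℂ) • w → s = s₀) {W : Set ℝ} (hWo : IsOpen W) (hW : s₀ ∈ W) :
    ∀ᶠ A : bandHerm n k in 𝓝 A₀, ∀ (s : ℝ) (v w : Fin n → ℂ), IsOrthonormalPair v w →
      A.1 *ᵥ v = (s : ℂ) • v → A.1 *ᵥ w = (s : ℂ) • w → s ∈ W := by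
  have hcA : Continuous fun q : bandHerm n k × ((Fin n → ℂ) × (Fin n → ℂ)) => q.1.1 := by fun_prop
  have hcv : Continuous fun q : bandHerm n k × ((Fin n → ℂ) × (Fin n → ℂ)) => q.1.1 *ᵥ q.2.1 :=
    hcA.matrix_mulVec (by fun_prop)
  have hcw : Continuous fun q : bandHerm n k × ((Fin n → ℂ) × (Fin n → ℂ)) => q.1.1 *ᵥ q.2.2 :=
    hcA.matrix_mulVec (by fun_prop)
  have hcs : Continuous fun q : bandHerm n k × ((Fin n → ℂ) × (Fin n → ℂ)) =>
      star q.2.1 ⬝ᵥ q.1.1 *ᵥ q.2.1 := by fun_prop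
  have hcsv : Continuous fun q : bandHerm n k × ((Fin n → ℂ) × (Fin n → ℂ)) =>
      (star q.2.1 ⬝ᵥ q.1.1 *ᵥ q.2.1) • q.2.1 := by fun_prop
  have hcsw : Continuous fun q : bandHerm n k × ((Fin n → ℂ) × (Fin n → ℂ)) =>
      (star q.2.1 ⬝ᵥ q.1.1 *ᵥ q.2.1) • q.2.2 := by fun_prop
  -- Writing the eigenvalue as the Rayleigh quotient of the first vector leaves only the compact set
  -- of orthonormal pairs to quantify over.
  have key := isCompact_orthonormalPairs.eventually_forall_of_forall_eventually (x₀ := A₀)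
    (P := fun (A : bandHerm n k) (p : (Fin n → ℂ) × (Fin n → ℂ)) =>
      A.1 *ᵥ p.1 = (star p.1 ⬝ᵥ A.1 *ᵥ p.1) • p.1 →
      A.1 *ᵥ p.2 = (star p.1 ⬝ᵥ A.1 *ᵥ p.1) • p.2 → (star p.1 ⬝ᵥ A.1 *ᵥ p.1).re ∈ W) ?_
  · filter_upwards [key] with A hA s v w hvw hv hw
    have h1 : star v ⬝ᵥ A.1 *ᵥ v = (s : ℂ) := by
      rw [hv, dotProduct_smul, hvw.1, smul_eq_mul, mul_one]
    have := hA (v, w) hvw (by rw [h1]; exact hv) (by rw [h1]; exact hw)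
    simpa [h1] using this
  · rintro ⟨v, w⟩ hvw
    by_cases h1 : A₀.1 *ᵥ v = (star v ⬝ᵥ A₀.1 *ᵥ v) • v
    · by_cases h2 : A₀.1 *ᵥ w = (star v ⬝ᵥ A₀.1 *ᵥ v) • w
      · have hre := eigenvalue_real (mem_bandHerm.1 A₀.2).1 hvw.1 h1
        have h3 := huniq _ v w hvw (by rw [hre]; exact h1) (by rw [hre]; exact h2)
        have h4 : (star v ⬝ᵥ A₀.1 *ᵥ v).re ∈ W := by rw [h3]; exact hW
        filter_upwards [(Complex.continuous_re.comp hcs).continuousAt.preimage_mem_nhds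
          (hWo.mem_nhds h4)] with q hq _ _
        exact hq
      · filter_upwards [(isOpen_ne_fun hcw hcsw).mem_nhds h2] with q hq _ h
        exact absurd h hq
    · filter_upwards [(isOpen_ne_fun hcv hcsv).mem_nhds h1] with q hq h
      exact absurd h hq

end Eigenvectors

/-! ### Bordered resolvents detecting double eigenvalues. -/

section Submersion

open Matrix

variable {n k : ℕ}

/-- The shifted matrix `A - s` as an endomorphism, linear in `(A, s)`. -/
noncomputable def shiftMap (n k : ℕ) :
    bandHerm n k × ℝ →L[ℝ] ((Fin n → ℂ) →L[ℂ] (Fin n → ℂ)) :=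
  LinearMap.toContinuousLinearMap
    (((LinearMap.toContinuousLinearMap.toLinearMap ∘ₗ
      (Matrix.toLin' (R := ℂ) (m := Fin n) (n := Fin n)).toLinearMap).restrictScalars ℝ) ∘ₗ
      ((bandHerm n k).subtype ∘ₗ LinearMap.fst ℝ _ _ -
        LinearMap.toSpanSingleton ℝ _ (1 : Matrix (Fin n) (Fin n) ℂ) ∘ₗ LinearMap.snd ℝ _ _))

theorem shiftMap_apply (p : bandHerm n k × ℝ) (x : Fin n → ℂ) :
    shiftMap n k p x = p.1.1 *ᵥ x - (p.2 : ℂ) • x := by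
  change (p.1.1 - p.2 • (1 : Matrix (Fin n) (Fin n) ℂ)) *ᵥ x = _
  rw [sub_mulVec, smul_mulVec, one_mulVec]
  rfl

/-- The shifted matrix `A - s` plus the orthogonal projection to the span of the orthonormal
vectors `v` and `w`. -/
noncomputable def bordered (v w : Fin n → ℂ) (p : bandHerm n k × ℝ) :
    (Fin n → ℂ) →L[ℂ] (Fin n → ℂ) :=
  shiftMap n k p + LinearMap.toContinuousLinearMap
    ((LinearMap.toSpanSingleton ℂ _ v) ∘ₗ (dotProductBilin ℂ ℂ (star v)) +
      (LinearMap.toSpanSingleton ℂ _ w) ∘ₗ (dotProductBilin ℂ ℂ (star w)))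

theorem bordered_apply (v w : Fin n → ℂ) (p : bandHerm n k × ℝ) (x : Fin n → ℂ) :
    bordered v w p x
      = p.1.1 *ᵥ x - (p.2 : ℂ) • x + ((star v ⬝ᵥ x) • v + (star w ⬝ᵥ x) • w) := by
  rw [← shiftMap_apply]; rfl

theorem hasStrictFDerivAt_bordered (v w : Fin n → ℂ) (p : bandHerm n k × ℝ) :
    HasStrictFDerivAt (bordered v w) (shiftMap n k) p :=
  (shiftMap n k).hasStrictFDerivAt.add_const _

theorem contDiff_bordered (v w : Fin n → ℂ) : ContDiff ℝ ω (bordered (k := k) v w) :=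
  (shiftMap n k).contDiff.add contDiff_const

theorem star_dotProduct_bordered (v w : Fin n → ℂ) (p : bandHerm n k × ℝ) (x y : Fin n → ℂ) :
    star x ⬝ᵥ bordered v w p y = star (star y ⬝ᵥ bordered v w p x) := by
  have h1 := star_dotProduct_mulVec_comm (mem_bandHerm.1 p.1.2).1 x y
  have h2 : ∀ a b : Fin n → ℂ, star a ⬝ᵥ b = star (star b ⬝ᵥ a) := fun a b => by
    rw [← star_dotProduct_star, star_star]
  simp only [bordered_apply, dotProduct_add, dotProduct_sub, dotProduct_smul, star_add, star_sub,
    h1, smul_eq_mul, star_mul']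
  rw [h2 x y, h2 x v, h2 x w, h2 v y, h2 w y]
  simp only [Complex.star_def, Complex.conj_ofReal]
  ring

/-- The matrix coefficients of the inverse of the bordered endomorphism. -/
noncomputable def resolventCoeff (v w x y : Fin n → ℂ) (p : bandHerm n k × ℝ) : ℂ :=
  star x ⬝ᵥ Ring.inverse (bordered v w p) y

/-- The linear functional `T ↦ star x ⬝ᵥ T y`. -/
noncomputable def coeffCLM (x y : Fin n → ℂ) : ((Fin n → ℂ) →L[ℂ] (Fin n → ℂ)) →L[ℂ] ℂ :=
  (LinearMap.toContinuousLinearMap (dotProductBilin ℂ ℂ (star x))).comp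
    (ContinuousLinearMap.apply ℂ (Fin n → ℂ) y)

theorem contDiffAt_resolventCoeff {v w : Fin n → ℂ} (x y : Fin n → ℂ) {p : bandHerm n k × ℝ}
    (hp : IsUnit (bordered v w p)) : ContDiffAt ℝ ω (resolventCoeff v w x y) p := by
  obtain ⟨u, hu⟩ := hp
  have h1 : ContDiffAt ℝ ω (Ring.inverse : ((Fin n → ℂ) →L[ℂ] (Fin n → ℂ)) → _)
      (bordered v w p) := by
    rw [← hu]; exact (contDiffAt_ringInverse ℂ u).restrict_scalars ℝ
  have h2 := h1.comp p (contDiff_bordered v w).contDiffAt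
  exact (((coeffCLM x y).restrictScalars ℝ).contDiff.contDiffAt).comp p h2

theorem hasStrictFDerivAt_resolventCoeff {v w : Fin n → ℂ} (x y : Fin n → ℂ)
    {p : bandHerm n k × ℝ} (hp : IsUnit (bordered v w p)) :
    ∃ D : bandHerm n k × ℝ →L[ℝ] ℂ, HasStrictFDerivAt (resolventCoeff v w x y) D p ∧
      ∀ q, D q = - (star x ⬝ᵥ Ring.inverse (bordered v w p)
        (shiftMap n k q (Ring.inverse (bordered v w p) y))) := by
  obtain ⟨u, hu⟩ := hp
  have h1 := (hasStrictFDerivAt_ringInverse (𝕜 := ℂ) u).restrictScalars ℝ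
  rw [hu] at h1
  have h2 := h1.comp p (hasStrictFDerivAt_bordered v w p)
  refine ⟨_, ((coeffCLM x y).restrictScalars ℝ).hasStrictFDerivAt.comp p h2, fun q => ?_⟩
  rw [← hu, Ring.inverse_unit, ← dotProduct_neg]
  rfl

theorem bordered_inverse_apply {v w : Fin n → ℂ} {p : bandHerm n k × ℝ}
    (hp : IsUnit (bordered v w p)) (y : Fin n → ℂ) :
    bordered v w p (Ring.inverse (bordered v w p) y) = y := by
  have := congrArg (fun T : (Fin n → ℂ) →L[ℂ] (Fin n → ℂ) => T y) (Ring.mul_inverse_cancel _ hp)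
  simpa using this

theorem inverse_bordered_apply {v w : Fin n → ℂ} {p : bandHerm n k × ℝ}
    (hp : IsUnit (bordered v w p)) (y : Fin n → ℂ) :
    Ring.inverse (bordered v w p) (bordered v w p y) = y := by
  have := congrArg (fun T : (Fin n → ℂ) →L[ℂ] (Fin n → ℂ) => T y) (Ring.inverse_mul_cancel _ hp)
  simpa using this

theorem resolventCoeff_comm {v w : Fin n → ℂ} {p : bandHerm n k × ℝ}
    (hp : IsUnit (bordered v w p)) (x y : Fin n → ℂ) :
    resolventCoeff v w x y p = star (resolventCoeff v w y x p) := by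
  have h2 : ∀ a b : Fin n → ℂ, star a ⬝ᵥ b = star (star b ⬝ᵥ a) := fun a b => by
    rw [← star_dotProduct_star, star_star]
  rw [resolventCoeff, resolventCoeff, ← h2]
  conv_lhs => rw [← bordered_inverse_apply hp x]
  rw [h2, ← star_dotProduct_bordered, bordered_inverse_apply hp]

theorem isUnit_bordered {v w : Fin n → ℂ} {p : bandHerm n k × ℝ}
    (h : ∀ x, bordered v w p x = 0 → x = 0) : IsUnit (bordered v w p) := by
  rw [ContinuousLinearMap.isUnit_iff_bijective]
  have h1 : Function.Injective (bordered v w p).toLinearMap :=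
    (injective_iff_map_eq_zero _).2 h
  exact ⟨h1, LinearMap.injective_iff_surjective.1 h1⟩

/-- If the inverse of `A - s + P` compresses to the identity on `span {v, w}`, then `P` already
reproduces `v` and `w` from their preimages, so `A - s` kills these two preimages. -/
theorem isDerogatory_of_resolventCoeff {v w : Fin n → ℂ} {p : bandHerm n k × ℝ}
    (hp : IsUnit (bordered v w p)) (h1 : resolventCoeff v w v v p = 1)
    (h2 : resolventCoeff v w w v p = 0) (h3 : resolventCoeff v w v w p = 0)
    (h4 : resolventCoeff v w w w p = 1) : IsDerogatory p.1.1 := by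
  have e1 := bordered_inverse_apply hp v
  have e2 := bordered_inverse_apply hp w
  unfold resolventCoeff at h1 h2 h3 h4
  rw [bordered_apply, h1, h2, one_smul, zero_smul, add_zero, add_eq_right, sub_eq_zero] at e1
  rw [bordered_apply, h3, h4, one_smul, zero_smul, zero_add, add_eq_right, sub_eq_zero] at e2
  exact isDerogatory_of_pair e1 e2 (linearIndependent_pair_of_dual h1 h2 h3 h4)

/-- On the span of `x` and `y` the bordered map equals the projection to `span {v, w}`.
Invertibility makes the 2×2 matrix of this projection invertible, so the inverse sends `v` and `w`
to vectors whose projections are `v` and `w`. -/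
theorem resolventCoeff_of_pair {v w : Fin n → ℂ} {p : bandHerm n k × ℝ}
    (hp : IsUnit (bordered v w p)) {x y : Fin n → ℂ} (hxy : IsOrthonormalPair x y)
    (hx : p.1.1 *ᵥ x = (p.2 : ℂ) • x) (hy : p.1.1 *ᵥ y = (p.2 : ℂ) • y) :
    resolventCoeff v w v v p = 1 ∧ resolventCoeff v w w v p = 0 ∧
      resolventCoeff v w v w p = 0 ∧ resolventCoeff v w w w p = 1 := by
  set a := star v ⬝ᵥ x with ha
  set b := star w ⬝ᵥ x with hb
  set c := star v ⬝ᵥ y with hc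
  set d := star w ⬝ᵥ y with hd
  have hcomb : ∀ α β : ℂ, bordered v w p (α • x + β • y)
      = (α * a + β * c) • v + (α * b + β * d) • w := by
    intro α β
    rw [bordered_apply, mulVec_add, mulVec_smul, mulVec_smul, hx, hy]
    simp only [dotProduct_add, dotProduct_smul, smul_eq_mul, ← ha, ← hb, ← hc, ← hd]
    have : α • (p.2 : ℂ) • x + β • (p.2 : ℂ) • y - (p.2 : ℂ) • (α • x + β • y) = 0 := by
      rw [smul_add, smul_comm α, smul_comm β, sub_self]
    rw [this, zero_add]
  have hinj : ∀ α β : ℂ, α * a + β * c = 0 → α * b + β * d = 0 → α = 0 ∧ β = 0 := by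
    intro α β h1 h2
    have h3 := hcomb α β
    rw [h1, h2, zero_smul, zero_smul, add_zero] at h3
    have h4 := inverse_bordered_apply hp (α • x + β • y)
    rw [h3, map_zero] at h4
    have e1 := congrArg (fun z => star x ⬝ᵥ z) h4
    have e2 := congrArg (fun z => star y ⬝ᵥ z) h4
    simp only [dotProduct_zero, dotProduct_add, dotProduct_smul, hxy.1, hxy.2.1, hxy.2.2,
      hxy.symm, smul_eq_mul, mul_one, mul_zero, add_zero, zero_add] at e1 e2
    exact ⟨e1.symm, e2.symm⟩
  have hdet : a * d - b * c ≠ 0 := by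
    intro h0
    obtain ⟨h1, h2⟩ := hinj d (-b) (by linear_combination h0) (by ring)
    obtain ⟨h3, h4⟩ := hinj (-c) a (by ring) (by linear_combination h0)
    obtain ⟨h5, -⟩ := hinj 1 0 (by rw [h4]; simp) (by rw [neg_eq_zero.1 h2]; simp)
    exact one_ne_zero h5
  set δ := a * d - b * c with hδ
  have hv : Ring.inverse (bordered v w p) v = (d / δ) • x + (-b / δ) • y := by
    rw [← inverse_bordered_apply hp ((d / δ) • x + (-b / δ) • y), hcomb]
    have h1 : d / δ * a + -b / δ * c = 1 := by field_simp; rw [hδ]; ring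
    have h2 : d / δ * b + -b / δ * d = 0 := by field_simp; ring
    rw [h1, h2, one_smul, zero_smul, add_zero]
  have hw : Ring.inverse (bordered v w p) w = (-c / δ) • x + (a / δ) • y := by
    rw [← inverse_bordered_apply hp ((-c / δ) • x + (a / δ) • y), hcomb]
    have h1 : -c / δ * a + a / δ * c = 0 := by field_simp; ring
    have h2 : -c / δ * b + a / δ * d = 1 := by field_simp; rw [hδ]; ring
    rw [h1, h2, one_smul, zero_smul, zero_add]
  simp only [resolventCoeff, hv, hw, dotProduct_add, dotProduct_smul, ← ha, ← hb, ← hc, ← hd,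
    smul_eq_mul]
  refine ⟨?_, ?_, ?_, ?_⟩ <;> field_simp <;> rw [hδ] <;> ring

end Submersion

/-! ### The derogatory set as a submersion's zero set. -/

section Smoothness

open Matrix

variable {n k : ℕ}

/-- Surjectivity of the derivative is an open condition on the point. -/
theorem eventually_surjective_fderiv {E F : Type*} [NormedAddCommGroup E] [NormedSpace ℝ E]
    [NormedAddCommGroup F] [NormedSpace ℝ F] [FiniteDimensional ℝ F] {f : E → F} {x : E}
    (hf : ContDiffAt ℝ ω f x) (h : Function.Surjective (fderiv ℝ f x)) :
    ∀ᶠ y in 𝓝 x, Function.Surjective (fderiv ℝ f y) := by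
  have : CompleteSpace F := FiniteDimensional.complete ℝ F
  obtain ⟨r, hr⟩ := (fderiv ℝ f x).toLinearMap.exists_rightInverse_of_surjective
    (LinearMap.range_eq_top.2 h)
  let r' : F →L[ℝ] E := LinearMap.toContinuousLinearMap r
  have hc : ContinuousAt (fun y => (fderiv ℝ f y).comp r') x :=
    ((hf.fderiv_right (m := 0) (by simp)).continuousAt).clm_comp continuousAt_const
  have hu : IsUnit ((fderiv ℝ f x).comp r' : F →L[ℝ] F) := by
    have : (fderiv ℝ f x).comp r' = 1 := by ext1 z; exact LinearMap.congr_fun hr z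
    rw [this]; exact isUnit_one
  filter_upwards [hc (Units.isOpen.mem_nhds hu)] with y hy z
  have hy' : IsUnit ((fderiv ℝ f y).comp r' : F →L[ℝ] F) := hy
  obtain ⟨a, ha⟩ := (ContinuousLinearMap.isUnit_iff_bijective.1 hy').2 z
  exact ⟨r' a, ha⟩

/-- The real coordinates of a complex number and the real part of another one. -/
noncomputable def realTriple : ℂ × ℂ →L[ℝ] EuclideanSpace ℝ (Fin 3) :=
  LinearMap.toContinuousLinearMap
    { toFun := fun p => !₂[p.1.re, p.1.im, p.2.re]
      map_add' := by
        intro p q; ext i; fin_cases i <;> simp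
      map_smul' := by
        intro c p; ext i; fin_cases i <;> simp }

theorem realTriple_apply (p : ℂ × ℂ) : realTriple p = !₂[p.1.re, p.1.im, p.2.re] := rfl

theorem realTriple_eq_zero_iff (p : ℂ × ℂ) : realTriple p = 0 ↔ p.1 = 0 ∧ p.2.re = 0 := by
  rw [realTriple_apply]
  constructor
  · intro h
    have h0 := congrArg (fun q : EuclideanSpace ℝ (Fin 3) => q 0) h
    have h1 := congrArg (fun q : EuclideanSpace ℝ (Fin 3) => q 1) h
    have h2 := congrArg (fun q : EuclideanSpace ℝ (Fin 3) => q 2) h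
    simp at h0 h1 h2
    exact ⟨Complex.ext h0 h1, h2⟩
  · rintro ⟨h1, h2⟩
    ext i; fin_cases i <;> simp [h1, h2]

/-- Near a matrix with a unique multiple eigenvalue, which is double with transversal eigenspace,
the derogatory matrices are the zero set of a submersion to `ℝ³`. -/
theorem exists_submersion {A₀ : bandHerm n k} {s₀ : ℝ} {v w : Fin n → ℂ}
    (hvw : IsOrthonormalPair v w) (hv : A₀.1 *ᵥ v = (s₀ : ℂ) • v) (hw : A₀.1 *ᵥ w = (s₀ : ℂ) • w)
    (hcor : ∀ x, A₀.1 *ᵥ x = (s₀ : ℂ) • x → star v ⬝ᵥ x = 0 → star w ⬝ᵥ x = 0 → x = 0)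
    (hsurj : Function.Surjective (compression k v w))
    (huniq : ∀ (s : ℝ) (v w : Fin n → ℂ), IsOrthonormalPair v w → A₀.1 *ᵥ v = (s : ℂ) • v →
      A₀.1 *ᵥ w = (s : ℂ) • w → s = s₀) :
    ∃ U : Set (bandHerm n k), IsOpen U ∧ A₀ ∈ U ∧
      ∃ f : bandHerm n k → EuclideanSpace ℝ (Fin 3), ContDiffOn ℝ ∞ f U ∧
        (∀ y ∈ U, Function.Surjective (fderiv ℝ f y)) ∧
        ∀ y ∈ U, y ∈ derogatorySet n k ↔ f y = 0 := by
  set p₀ : bandHerm n k × ℝ := (A₀, s₀) with hp₀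
  have hbv : bordered v w p₀ v = v := by
    rw [bordered_apply]; simp [hp₀, hv, hvw.1, hvw.symm]
  have hbw : bordered v w p₀ w = w := by
    rw [bordered_apply]; simp [hp₀, hw, hvw.2.1, hvw.2.2]
  have hunit : IsUnit (bordered v w p₀) := by
    refine isUnit_bordered fun x hx => ?_
    have h1 : star v ⬝ᵥ x = 0 := by
      have := star_dotProduct_bordered v w p₀ v x
      rw [hx, dotProduct_zero, hbv, ← star_dotProduct_star, star_star] at this
      exact this.symm
    have h2 : star w ⬝ᵥ x = 0 := by
      have := star_dotProduct_bordered v w p₀ w x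
      rw [hx, dotProduct_zero, hbw, ← star_dotProduct_star, star_star] at this
      exact this.symm
    rw [bordered_apply, h1, h2, zero_smul, zero_smul, add_zero, add_zero, sub_eq_zero] at hx
    exact hcor x hx h1 h2
  have hRv : Ring.inverse (bordered v w p₀) v = v := by
    have := inverse_bordered_apply hunit v
    rwa [hbv] at this
  have hRw : Ring.inverse (bordered v w p₀) w = w := by
    have := inverse_bordered_apply hunit w
    rwa [hbw] at this
  -- The bordered map is self-adjoint, so its inverse can be moved onto the fixed vector `x`.
  have hRdual : ∀ x, bordered v w p₀ x = x → ∀ y,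
      star x ⬝ᵥ Ring.inverse (bordered v w p₀) y = star x ⬝ᵥ y := by
    intro x hx y
    have := star_dotProduct_bordered v w p₀ x (Ring.inverse (bordered v w p₀) y)
    rw [hx, bordered_inverse_apply hunit, ← star_dotProduct_star, star_star] at this
    exact this.symm
  have hderiv : ∀ x y, bordered v w p₀ x = x → Ring.inverse (bordered v w p₀) y = y →
      ∃ D : bandHerm n k × ℝ →L[ℝ] ℂ, HasStrictFDerivAt (resolventCoeff v w x y) D p₀ ∧
        ∀ q, D q = -(star x ⬝ᵥ q.1.1 *ᵥ y) + (q.2 : ℂ) * (star x ⬝ᵥ y) := by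
    intro x y hx hy
    obtain ⟨D, hD, hDq⟩ := hasStrictFDerivAt_resolventCoeff x y hunit
    refine ⟨D, hD, fun q => ?_⟩
    rw [hDq, hy, hRdual x hx, shiftMap_apply, dotProduct_sub, dotProduct_smul, smul_eq_mul]
    ring
  obtain ⟨Dvv, hDvv, hDvv'⟩ := hderiv v v hbv hRv
  obtain ⟨Dww, hDww, hDww'⟩ := hderiv w w hbw hRw
  obtain ⟨Dvw, hDvw, hDvw'⟩ := hderiv v w hbv hRw
  have hcoef0 := resolventCoeff_of_pair hunit hvw hv hw
  -- the eigenvalue as an implicit function of the matrix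
  let T : bandHerm n k × ℝ → ℝ := fun p =>
    (resolventCoeff v w v v p).re + (resolventCoeff v w w w p).re
  have hTc : ContDiffAt ℝ ω T p₀ :=
    (Complex.reCLM.contDiff.contDiffAt.comp p₀ (contDiffAt_resolventCoeff v v hunit)).add
      (Complex.reCLM.contDiff.contDiffAt.comp p₀ (contDiffAt_resolventCoeff w w hunit))
  have hTd : HasStrictFDerivAt T (Complex.reCLM.comp Dvv + Complex.reCLM.comp Dww) p₀ :=
    (Complex.reCLM.hasStrictFDerivAt.comp p₀ hDvv).add
      (Complex.reCLM.hasStrictFDerivAt.comp p₀ hDww)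
  have hT0 : T p₀ = 2 := by
    simp only [T, hcoef0.1, hcoef0.2.2.2]; norm_num
  -- Each diagonal coefficient has derivative `1` in the eigenvalue variable, so the trace `T` has
  -- derivative `2`.
  have hinv : (fderiv ℝ T p₀ ∘L .inr ℝ (bandHerm n k) ℝ).IsInvertible := by
    refine ⟨ContinuousLinearEquiv.unitsEquivAut ℝ (Units.mk0 2 two_ne_zero), ?_⟩
    ext
    rw [hTd.hasFDerivAt.fderiv]
    simp [hDvv', hDww', hvw.1, hvw.2.1]
    norm_num
  obtain ⟨ψ, hψc, hψ0, hψeq, hψiff⟩ : ∃ ψ : bandHerm n k → ℝ, ContDiffAt ℝ ω ψ A₀ ∧ ψ A₀ = s₀ ∧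
      (∀ᶠ A in 𝓝 A₀, T (A, ψ A) = T p₀) ∧ ∀ᶠ p in 𝓝 p₀, T p = T p₀ ↔ ψ p.1 = p.2 :=
    ⟨hTc.implicitFunction (by simp) hinv, hTc.contDiffAt_implicitFunction (by simp) hinv,
      hTc.implicitFunction_apply_self (by simp) hinv,
      hTc.eventually_apply_implicitFunction (by simp) hinv,
      hTc.eventually_apply_eq_iff_implicitFunction (by simp) hinv⟩
  let γ : bandHerm n k → bandHerm n k × ℝ := fun A => (A, ψ A)
  have hγ0 : γ A₀ = p₀ := by simp only [γ, hψ0, hp₀]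
  have hγc : ContDiffAt ℝ ω γ A₀ := contDiffAt_id.prodMk hψc
  -- With the trace fixed at `2`, the Hermitian 2×2 matrix of resolvent coefficients is the identity
  -- exactly when its off-diagonal entry and the difference of its diagonal entries vanish.
  let f : bandHerm n k → EuclideanSpace ℝ (Fin 3) := fun A =>
    realTriple (resolventCoeff v w v w (γ A),
      resolventCoeff v w v v (γ A) - resolventCoeff v w w w (γ A))
  have hfc : ContDiffAt ℝ ω f A₀ := by
    have h1 : ∀ x y, ContDiffAt ℝ ω (fun A => resolventCoeff v w x y (γ A)) A₀ := fun x y => by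
      refine ContDiffAt.comp A₀ (g := resolventCoeff v w x y) ?_ hγc
      rw [hγ0]; exact contDiffAt_resolventCoeff x y hunit
    exact realTriple.contDiff.contDiffAt.comp A₀ ((h1 v w).prodMk ((h1 v v).sub (h1 w w)))
  have hfsurj : Function.Surjective (fderiv ℝ f A₀) := by
    have hψd : HasStrictFDerivAt ψ (fderiv ℝ ψ A₀) A₀ := hψc.hasStrictFDerivAt (by simp)
    have hγd : HasStrictFDerivAt γ ((ContinuousLinearMap.id ℝ _).prod (fderiv ℝ ψ A₀)) A₀ :=
      (hasStrictFDerivAt_id A₀).prodMk hψd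
    have h1 : ∀ x y D, HasStrictFDerivAt (resolventCoeff v w x y) D p₀ →
        HasStrictFDerivAt (fun A => resolventCoeff v w x y (γ A))
          (D.comp ((ContinuousLinearMap.id ℝ _).prod (fderiv ℝ ψ A₀))) A₀ := fun x y D hD => by
      refine HasStrictFDerivAt.comp A₀ (g := resolventCoeff v w x y) ?_ hγd
      rw [hγ0]; exact hD
    have h2 : HasStrictFDerivAt f _ A₀ := realTriple.hasStrictFDerivAt.comp A₀
      ((h1 v w _ hDvw).prodMk ((h1 v v _ hDvv).sub (h1 w w _ hDww)))
    rw [h2.hasFDerivAt.fderiv]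
    intro c
    -- The signs come from the derivative of an inverse. The variation of `ψ` adds a scalar matrix,
    -- which disappears off the diagonal and in the difference of the diagonal entries.
    obtain ⟨X, hX⟩ := hsurj (-c 2, 0, -(⟨c 0, c 1⟩ : ℂ))
    rw [compression_apply, Prod.mk.injEq, Prod.mk.injEq] at hX
    refine ⟨X, ?_⟩
    have e1 : Dvw (X, fderiv ℝ ψ A₀ X) = ⟨c 0, c 1⟩ := by
      rw [hDvw', hX.2.2, hvw.2.2, mul_zero, add_zero, neg_neg]
    have e2 : (Dvv (X, fderiv ℝ ψ A₀ X) - Dww (X, fderiv ℝ ψ A₀ X)).re = c 2 := by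
      rw [hDvv', hDww', hvw.1, hvw.2.1, Complex.sub_re, Complex.add_re, Complex.add_re,
        Complex.neg_re, Complex.neg_re, hX.1, hX.2.1]
      ring
    change realTriple (Dvw (X, fderiv ℝ ψ A₀ X),
      Dvv (X, fderiv ℝ ψ A₀ X) - Dww (X, fderiv ℝ ψ A₀ X)) = c
    rw [realTriple_apply, e1, e2]
    ext i; fin_cases i <;> rfl
  -- the zero set
  have hunit_ev : ∀ᶠ p in 𝓝 p₀, IsUnit (bordered v w p) :=
    (contDiff_bordered (k := k) v w).continuous.continuousAt.preimage_mem_nhds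
      (Units.isOpen.mem_nhds hunit)
  have hγt : Tendsto γ (𝓝 A₀) (𝓝 p₀) := hγ0 ▸ hγc.continuousAt
  obtain ⟨W₁, hW₁, W₂, hW₂, hW⟩ := mem_nhds_prod_iff.1 (hunit_ev.and hψiff)
  obtain ⟨W₃, hW₃W₂, hW₃o, hs₀W₃⟩ := mem_nhds_iff.1 hW₂
  have hzero : ∀ᶠ A in 𝓝 A₀, A ∈ derogatorySet n k ↔ f A = 0 := by
    filter_upwards [eventually_eigenvalue_mem huniq hW₃o hs₀W₃, hW₁, hγt hunit_ev, hψeq]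
      with A hA hAW₁ hAu hAψ
    constructor
    · intro hder
      obtain ⟨s, x, y, hxy, hx, hy⟩ :=
        exists_pair_of_isDerogatory (mem_bandHerm.1 A.2).1 hder
      have hmem : IsUnit (bordered v w (A, s)) ∧ (T (A, s) = T p₀ ↔ ψ A = s) :=
        hW (Set.mk_mem_prod hAW₁ (hW₃W₂ (hA s x y hxy hx hy)))
      have hco := resolventCoeff_of_pair hmem.1 hxy hx hy
      have hTs : T (A, s) = T p₀ := by
        rw [hT0]; simp only [T, hco.1, hco.2.2.2]; norm_num
      have hγA : γ A = (A, s) := Prod.ext rfl (hmem.2.1 hTs)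
      simp only [f, hγA]
      rw [realTriple_eq_zero_iff, hco.1, hco.2.2.1, hco.2.2.2]
      simp
    · intro hf0
      have hAu' : IsUnit (bordered v w (γ A)) := hAu
      have h1 := (realTriple_eq_zero_iff _).1 hf0
      simp only [Complex.sub_re] at h1
      have h2 : (resolventCoeff v w v v (γ A)).re + (resolventCoeff v w w w (γ A)).re = 2 := by
        rw [← hT0]; exact hAψ
      have hre : ∀ x, (resolventCoeff v w x x (γ A)).re = 1 → resolventCoeff v w x x (γ A) = 1 := by
        intro x hx
        have := Complex.conj_eq_iff_re.1 (resolventCoeff_comm hAu' x x).symm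
        rw [← this, hx, Complex.ofReal_one]
      have h3 : resolventCoeff v w v w (γ A) = 0 := h1.1
      have h4 : resolventCoeff v w w v (γ A) = 0 := by
        rw [resolventCoeff_comm hAu', h3, star_zero]
      have h5 := hre v (by linarith)
      have h6 := hre w (by linarith)
      exact isDerogatory_of_resolventCoeff (p := γ A) hAu' h5 h4 h3 h6
  -- Regularity of class `ω` at a point persists at nearby points, which is not automatic for class
  -- `∞` at a point.
  have hall := (hfc.eventually (by simp)).and ((eventually_surjective_fderiv hfc hfsurj).and hzero)
  obtain ⟨U, hU, hUo, hAU⟩ := mem_nhds_iff.1 hall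
  exact ⟨U, hUo, hAU, f, fun y hy => ((hU hy).1.of_le le_top).contDiffWithinAt,
    fun y hy => (hU hy).2.1, fun y hy => (hU hy).2.2⟩

end Smoothness

/-! ### Decomposition of the derogatory set and conclusion. -/

section Main

open Matrix

variable {n k : ℕ}

/-- The points near which the derogatory set is the zero set of a submersion to `ℝ³`. -/
def smoothLocus (n k : ℕ) : Set (bandHerm n k) :=
  {A | ∃ U : Set (bandHerm n k), IsOpen U ∧ A ∈ U ∧
    ∃ f : bandHerm n k → EuclideanSpace ℝ (Fin 3), ContDiffOn ℝ ∞ f U ∧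
      (∀ y ∈ U, Function.Surjective (fderiv ℝ f y)) ∧ ∀ y ∈ U, y ∈ derogatorySet n k ↔ f y = 0}

theorem isOpen_smoothLocus : IsOpen (smoothLocus n k) := by
  rw [isOpen_iff_mem_nhds]
  rintro A ⟨U, hU, hA, hf⟩
  exact mem_of_superset (hU.mem_nhds hA) fun B hB => ⟨U, hU, hB, hf⟩

theorem isSmoothSubmanifold_inter_smoothLocus :
    IsSmoothSubmanifold 3 (derogatorySet n k ∩ smoothLocus n k) := by
  rintro A ⟨-, U, hU, hA, f, hf, hsurj, hiff⟩
  refine ⟨U, hU, hA, f, hf, hsurj, ?_⟩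
  ext B
  constructor
  · rintro ⟨⟨hB, -⟩, hBU⟩
    exact ⟨hBU, (hiff B hBU).1 hB⟩
  · rintro ⟨hBU, hB⟩
    exact ⟨⟨(hiff B hBU).2 hB, U, hU, hBU, f, hf, hsurj, hiff⟩, hBU⟩

theorem exists_orthonormal_triple {v w x : Fin n → ℂ} (hvw : IsOrthonormalPair v w) (hx : x ≠ 0)
    (hvx : star v ⬝ᵥ x = 0) (hwx : star w ⬝ᵥ x = 0) :
    ∃ c : ℂ, ∀ a b, star (![v, w, c • x] a) ⬝ᵥ ![v, w, c • x] b = if a = b then 1 else 0 := by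
  let s : ℝ := ∑ i, Complex.normSq (x i)
  have hs : 0 < s := by
    obtain ⟨i, hi⟩ := Function.ne_iff.1 hx
    exact Finset.sum_pos' (fun i _ => Complex.normSq_nonneg _)
      ⟨i, Finset.mem_univ i, Complex.normSq_pos.2 hi⟩
  have hxx : star x ⬝ᵥ x = (s : ℂ) := by
    rw [dotProduct, Complex.ofReal_sum]
    exact Finset.sum_congr rfl fun j _ => Complex.normSq_eq_conj_mul_self.symm
  have hsq : ((Real.sqrt s : ℝ) : ℂ) ≠ 0 := by
    rw [Complex.ofReal_ne_zero]; exact (Real.sqrt_pos.2 hs).ne'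
  have hsq2 : ((Real.sqrt s : ℝ) : ℂ) * (Real.sqrt s : ℝ) = s := by
    rw [← Complex.ofReal_mul, Real.mul_self_sqrt hs.le]
  have hflip : ∀ y : Fin n → ℂ, star y ⬝ᵥ x = 0 → star x ⬝ᵥ y = 0 := fun y hy => by
    have := congrArg star hy
    rwa [← star_dotProduct_star, star_star, star_zero] at this
  refine ⟨((Real.sqrt s : ℝ) : ℂ)⁻¹, fun a b => ?_⟩
  fin_cases a <;> fin_cases b <;>
    simp [hvw.1, hvw.2.1, hvw.2.2, hvw.symm, hvx, hwx, hflip, hxx, ← hsq2, hsq]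

/-- A derogatory matrix outside the smooth locus is degenerate to first order or has two
different multiple eigenvalues. -/
theorem diff_smoothLocus_subset (hk : 0 < k) :
    derogatorySet n k \ smoothLocus n k ⊆
      {A : bandHerm n k | ∃ s : ℝ, finrank ℝ (bandTangent k (A.1 - s • 1) Set.univ) + 5
        ≤ finrank ℝ (bandHerm n k)} ∪
      {A : bandHerm n k | ∃ s t : ℝ, s ≠ t ∧
        (∃ v w, IsOrthonormalPair v w ∧ A.1 *ᵥ v = (s : ℂ) • v ∧ A.1 *ᵥ w = (s : ℂ) • w) ∧
        ∃ v w, IsOrthonormalPair v w ∧ A.1 *ᵥ v = (t : ℂ) • v ∧ A.1 *ᵥ w = (t : ℂ) • w ∧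
          Function.Surjective (compression k v w)} := by
  rintro A ⟨hA, hAs⟩
  by_contra hbad
  rw [Set.mem_union, not_or] at hbad
  obtain ⟨hb1, hb2⟩ := hbad
  obtain ⟨s, v, w, hvw, hv, hw⟩ := exists_pair_of_isDerogatory (mem_bandHerm.1 A.2).1 hA
  have hB := sub_smul_one_mem_bandHerm A.2 s
  have hsurj : Function.Surjective (compression k v w) := by
    by_contra hns
    exact hb1 ⟨s, finrank_bandTangent_add_five_le_of_not_surjective hk hB
      (sub_smul_one_mulVec_eq_zero hv) (sub_smul_one_mulVec_eq_zero hw) hvw hns⟩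
  refine hAs (exists_submersion hvw hv hw (fun x hx hvx hwx => ?_) hsurj
    fun t v' w' hvw' hv' hw' => ?_)
  · by_contra hx0
    obtain ⟨c, hc⟩ := exists_orthonormal_triple hvw hx0 hvx hwx
    refine hb1 ⟨s, finrank_bandTangent_add_five_le_of_corank hk hB (fun a => ?_) hc⟩
    have h1 : A.1 *ᵥ (c • x) = (s : ℂ) • c • x := by rw [mulVec_smul, hx, smul_comm]
    fin_cases a
    · exact sub_smul_one_mulVec_eq_zero hv
    · exact sub_smul_one_mulVec_eq_zero hw
    · exact sub_smul_one_mulVec_eq_zero h1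
  · by_contra hts
    exact hb2 ⟨t, s, hts, ⟨v', w', hvw', hv', hw'⟩, v, w, hvw, hv, hw, hsurj⟩

theorem nonempty_inter_smoothLocus (hk : 0 < k) (hkn : k < n) :
    (derogatorySet n k ∩ smoothLocus n k).Nonempty := by
  let i₀ : Fin n := ⟨0, by omega⟩
  let i₁ : Fin n := ⟨1, by omega⟩
  have hne : i₀ ≠ i₁ := fun h => by simpa [i₀, i₁] using congrArg Fin.val h
  -- Truncated subtraction gives the diagonal `0, 0, 1, 2, …`, with `0` as its only multiple
  -- eigenvalue. The eigenspace is spanned by two adjacent coordinate vectors, so `0 < k` makes the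
  -- compression onto.
  let d : Fin n → ℂ := fun i => (((i : ℕ) - 1 : ℕ) : ℂ)
  have hd : ∀ i j : Fin n, d i = d j → d i ≠ 0 → i = j := by
    intro i j hij hi
    simp only [d, Nat.cast_inj, ne_eq, Nat.cast_eq_zero] at hij hi
    exact Fin.ext (by omega)
  have hd0 : d i₀ = 0 := by simp [d, i₀]
  have hd1 : d i₁ = 0 := by simp [d, i₁]
  have hdz : ∀ i, d i = 0 → i = i₀ ∨ i = i₁ := by
    intro i hi
    simp only [d, Nat.cast_eq_zero] at hi
    have : (i : ℕ) = 0 ∨ (i : ℕ) = 1 := by omega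
    exact this.imp (fun h => Fin.ext h) fun h => Fin.ext h
  have hmem : Matrix.diagonal d ∈ bandHerm n k := by
    refine mem_bandHerm.2 ⟨?_, fun i j hij => ?_⟩
    · rw [isHermitian_diagonal_iff]
      intro i
      exact Complex.conj_natCast _
    · have : i = j := by by_contra h; exact hij (diagonal_apply_ne d h)
      simp [this]
  let v : Fin n → ℂ := Pi.single i₀ 1
  let w : Fin n → ℂ := Pi.single i₁ 1
  have hsv : ∀ x : Fin n → ℂ, star v ⬝ᵥ x = x i₀ := fun x => by
    simp only [v, ← Pi.single_star, star_one, single_dotProduct, one_mul]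
  have hsw : ∀ x : Fin n → ℂ, star w ⬝ᵥ x = x i₁ := fun x => by
    simp only [w, ← Pi.single_star, star_one, single_dotProduct, one_mul]
  have hvw : IsOrthonormalPair v w :=
    ⟨by rw [hsv]; simp [v], by rw [hsw]; simp [w], by rw [hsv]; simp [w, hne]⟩
  have heig : ∀ (s : ℂ) (x : Fin n → ℂ), Matrix.diagonal d *ᵥ x = s • x ↔
      ∀ i, d i * x i = s * x i := by
    intro s x
    rw [funext_iff]
    simp [mulVec_diagonal]
  have hv : Matrix.diagonal d *ᵥ v = ((0 : ℝ) : ℂ) • v := by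
    rw [heig]
    intro i
    by_cases h : i = i₀
    · rw [h, hd0, Complex.ofReal_zero]
    · simp [v, h]
  have hw : Matrix.diagonal d *ᵥ w = ((0 : ℝ) : ℂ) • w := by
    rw [heig]
    intro i
    by_cases h : i = i₁
    · rw [h, hd1, Complex.ofReal_zero]
    · simp [w, h]
  refine ⟨⟨Matrix.diagonal d, hmem⟩, isDerogatory_of_pair hv hw
    (linearIndependent_pair_of_dual hvw.1 hvw.symm hvw.2.2 hvw.2.1),
    exists_submersion hvw hv hw ?_ ?_ ?_⟩
  · intro x hx hvx hwx
    rw [hsv] at hvx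
    rw [hsw] at hwx
    have hx' := (heig _ x).1 hx
    ext i
    by_contra hi
    have h1 := hx' i
    rw [Complex.ofReal_zero, zero_mul] at h1
    rcases hdz i ((mul_eq_zero.1 h1).resolve_right hi) with rfl | rfl
    · exact hi hvx
    · exact hi hwx
  · rintro ⟨a, b, z⟩
    -- The halves compensate for `bandUnit i i`, which adds its argument and the conjugate at the
    -- same diagonal entry.
    let X : bandHerm n k := ⟨bandUnit i₀ i₀ (a / 2) + bandUnit i₁ i₁ (b / 2) + bandUnit i₀ i₁ z,
      add_mem (add_mem (bandUnit_mem (by simp) _) (bandUnit_mem (by simp) _))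
        (bandUnit_mem (by simp [i₀, i₁]; omega) _)⟩
    have hX : ∀ x y : Fin n → ℂ, star x ⬝ᵥ X.1 *ᵥ y
        = star x ⬝ᵥ bandUnit i₀ i₀ (a / 2) *ᵥ y + star x ⬝ᵥ bandUnit i₁ i₁ (b / 2) *ᵥ y
          + star x ⬝ᵥ bandUnit i₀ i₁ z *ᵥ y := by
      intro x y
      rw [← dotProduct_add, ← dotProduct_add, ← add_mulVec, ← add_mulVec]
    refine ⟨X, ?_⟩
    rw [compression_apply, hX, hX, hX]
    simp only [star_dotProduct_bandUnit]
    simp [v, w, hne, hne.symm]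
  · intro s x y hxy hx hy
    by_contra hs
    have hs' : (s : ℂ) ≠ 0 := Complex.ofReal_ne_zero.2 hs
    have hx' := (heig _ x).1 hx
    have hy' := (heig _ y).1 hy
    have hx0 : x ≠ 0 := by rintro rfl; simpa using hxy.1
    obtain ⟨i, hi⟩ := Function.ne_iff.1 hx0
    have hdi : d i = s := mul_right_cancel₀ hi (hx' i)
    have hyj : ∀ j, j ≠ i → y j = 0 := by
      intro j hj
      by_contra h0
      have hdj : d j = s := mul_right_cancel₀ h0 (hy' j)
      exact hj (hd j i (hdj.trans hdi.symm) (hdj ▸ hs'))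
    have h1 : star (x i) * y i = 0 := by
      have h2 : star x ⬝ᵥ y = star (x i) * y i :=
        Finset.sum_eq_single (f := fun j => star x j * y j) i
          (fun j _ hj => by simp only [hyj j hj, mul_zero])
          (fun h => absurd (Finset.mem_univ i) h)
      rw [← h2, hxy.2.2]
    have hyi : y i = 0 := (mul_eq_zero.1 h1).resolve_left (star_ne_zero.2 hi)
    have hy0 : y = 0 := by
      ext j
      by_cases hj : j = i
      · rw [hj, hyi]; rfl
      · exact hyj j hj
    rw [hy0] at hxy
    simpa using hxy.2.1

theorem hasCodimension_derogatorySet (hk : 0 < k) (hkn : k < n) :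
    HasCodimension (derogatorySet n k) 3 := by
  refine ⟨derogatorySet n k ∩ smoothLocus n k, Set.inter_subset_left,
    nonempty_inter_smoothLocus hk hkn, ⟨smoothLocus n k, isOpen_smoothLocus, rfl⟩,
    isSmoothSubmanifold_inter_smoothLocus, ?_⟩
  rw [Set.sdiff_self_inter]
  have h1 : dimH (derogatorySet n k \ smoothLocus n k) ≤ (finrank ℝ (bandHerm n k) - 4 : ℕ) := by
    refine (dimH_mono (diff_smoothLocus_subset hk)).trans ?_
    rw [dimH_union]
    exact max_le dimH_degenerate_le dimH_two_double_eigenvalues_le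
  -- Needed because `finrank - 4` is a truncated subtraction.
  have h4 := four_le_finrank_bandHerm hk hkn
  calc dimH (derogatorySet n k \ smoothLocus n k) + (3 : ℕ)
      ≤ ((finrank ℝ (bandHerm n k) - 4 : ℕ) : ENNReal) + (3 : ℕ) := by gcongr
    _ < finrank ℝ (bandHerm n k) := by
      rw [← Nat.cast_add, Nat.cast_lt]; omega

end Main

end BandedHermitian

theorem mainTheorem4 (n k : ℕ) (hk : 0 < k) (hkn : k < n) :
    ((Module.finrank ℝ (BandedHermitian.bandHerm n k) : ℤ) =
        (n : ℤ) * (2 * k + 1) - k * (k + 1)) ∧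
      BandedHermitian.HasCodimension (BandedHermitian.derogatorySet n k) 3 ∧
      dimH (BandedHermitian.derogatorySet n k) + 3 =
        Module.finrank ℝ (BandedHermitian.bandHerm n k) := by
  have h := BandedHermitian.hasCodimension_derogatorySet hk hkn
  exact ⟨BandedHermitian.finrank_bandHerm hkn, h, BandedHermitian.dimH_eq_of_hasCodimension h⟩
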